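/- **Theorem 4.1.** Let $\mathbb K$ be an algebraically closed field, let $n\ge 1$, $[n]=\{1,\dots,n\}$, and write $w=(w_1,\dots,w_n)$ with $w_i=w(i)$ for $w\in S_n$. *Orders.* For subsets of $[n]$ put $\{i_1<\dots<i_s\}\le\{j_1<\dots<j_t\}$ if $s\ge t$ and $i_r\le j_r$ for $1\le r\le t$. The Bruhat order on $S_n$ is: $v\le w$ if $\{v_1,\dots,v_k\}\le\{w_1,\dots,w_k\}$ for all $k\in[n]$. For $v\le w$ let $T_w^v$ be the set of all $J$ with $\varnothing\ne J\subsetneq[n]$ and $\{v_1,\dots,v_{|J|}\}\le J\le\{w_1,\dots,w_{|J|}\}$. *The set $\mathcal T_n$.* For $w\in S_n$, $n\ge 2$, let $\underline w\in S_{n-1}$ be obtained by deleting the entry $n$ from $(w_1,\dots,w_n)$. For $v,w\in S_n$ with $n\geq 2$, $v_t=w_{t'}=n$ and $v_s=w_{s'}=n-1$, the pair $(v,w)$ is *compatible* if either $t=t'$, or $t'<t$, $s'\le t$, $t'\le s$, $w_{t'}>w_{t'+1}>\dots>w_t$ and $v_t>v_{t-1}>\dots>v_{t'}$. Put $\mathcal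 T_1=\{(\mathrm{id},\mathrm{id})\}$ and, for $n\ge 1$, $\mathcal T_{n+1}=\{(v,w)\in S_{n+1}\times S_{n+1}:(\underline v,\underline w)\in\mathcal T_n\text{ and }(v,w)\text{ compatible}\}$. *Ideals.* Let $X=(x_{i,j})$ be an $(n-1)\times n$ matrix of indeterminates, and let $I_n$ be the kernel of the $\mathbb K$-algebra map $\varphi_n:\mathbb K[P_J:\varnothing\ne J\subsetneq[n]]\to\mathbb K[x_{i,j}]$ that sends $P_J$ to the minor of $X$ with rows $1,\dots,|J|$ and columns $J$. Give $x_{i,j}$ the weight $M_{i,j}=(i-1)(n-j+1)$. For any weight, the initial form of a polynomial is the sum of its terms of lowest weight, and the initial ideal of an ideal is generated by the initial forms of its elements. Let $\mathrm{in}_M(P_J)$ be the initial form of $\varphi_n(P_J)$ with respect to $M$, give $P_J$ the weight of the terms of $\mathrm{in}_M(P_J)$, and let $\mathrm{in}(I_n)$ be the initial ideal of $I_n$ with respect to these weights on the variables $P_J$. Let $\mathrm{in}(I_n)|_{T_w^v}\subseteq\mathbb K[P_J:J\in T_w^v]$ be the ideal generated by all polynomials obtained from elements of $\mathrm{in}(I_n)$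 by setting $P_J=0$ for all $J\notin T_w^v$. Let $\phi_n|_w^v:\mathbb K[P_J:J\in T_w^v]\to\mathbb K[x_{i,j}]$ be the $\mathbb K$-algebra map with $P_J\mapsto\mathrm{in}_M(P_J)$. Let $v,w\in S_n$ with $v\le w$. Then $\mathrm{in}(I_n)|_{T_w^v}$ contains no monomial if and only if $(v,w)\in\mathcal T_n$. Moreover, if $(v,w)\in\mathcal T_n$, then $\mathrm{in}(I_n)|_{T_w^v}$ is toric, i.e. it is a prime ideal generated by differences of two monomials, and $\mathrm{in}(I_n)|_{T_w^v}=\ker(\phi_n|_w^v)$. -/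

import Mathlib

namespace FlagRichardson

open MvPolynomial

noncomputable section

/-! ### Subsets and permutations

The set `[n] = {1, …, n}` is modelled by `Fin n`, so all entries and positions are shifted by one.
A permutation `w = (w₁, …, wₙ)` is `w : Equiv.Perm (Fin n)`, with `w i` the entry in position `i`. -/

/-- The order on subsets: `{i₁ < ⋯ < iₛ} ≤ {j₁ < ⋯ < jₜ}` if `s ≥ t` and `iᵣ ≤ jᵣ` for all
`r ≤ t`. -/
def SubsetLE {n : ℕ} (I J : Finset (Fin n)) : Prop :=
  ∃ h : J.card ≤ I.card, ∀ r : Fin J.card,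
    I.orderEmbOfFin rfl (Fin.castLE h r) ≤ J.orderEmbOfFin rfl r

/-- The set `{w₁, …, w_k}` of the first `k` entries of `w`. -/
def firstValues {n : ℕ} (w : Equiv.Perm (Fin n)) (k : ℕ) : Finset (Fin n) :=
  (Finset.univ.filter fun i : Fin n => (i : ℕ) < k).image w

/-- The Bruhat order: `{v₁, …, v_k} ≤ {w₁, …, w_k}` for all `k`. -/
def BruhatLE {n : ℕ} (v w : Equiv.Perm (Fin n)) : Prop :=
  ∀ k ∈ Finset.Icc 1 n, SubsetLE (firstValues v k) (firstValues w k)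

/-! ### Compatible pairs and the set of pairs `𝒯ₙ` -/

/-- The induced permutation, obtained by deleting the largest entry from
`w = (w₁, …, wₙ₊₁)`. -/
def induced {n : ℕ} (w : Equiv.Perm (Fin (n + 1))) : Equiv.Perm (Fin n) :=
  ((finSuccAboveEquiv (w.symm (Fin.last n))).trans
    (w.subtypeEquiv fun a => by simp [Equiv.eq_symm_apply])).trans
      (finSuccAboveEquiv (Fin.last n)).symm

/-- The entries of the induced permutation are those of `w` with the position of the largest entry
skipped. -/
theorem castSucc_induced {n : ℕ} (w : Equiv.Perm (Fin (n + 1))) (i : Fin n) :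
    (induced w i).castSucc = w ((w.symm (Fin.last n)).succAbove i) := by
  have h : finSuccAboveEquiv (Fin.last n) (induced w i) =
      w.subtypeEquiv (p := fun a => a ≠ w.symm (Fin.last n)) (q := fun b => b ≠ Fin.last n)
        (fun a => by simp [Equiv.eq_symm_apply])
        (finSuccAboveEquiv (w.symm (Fin.last n)) i) := by
    simp [induced]
  have h' := congrArg Subtype.val h
  simpa [finSuccAboveEquiv_apply] using h'

/-- Compatible pairs `(v, w)`. Here `t, t'` are the positions of the largest entry in `v, w`, and
`s, s'` are the positions of the second largest entry in `v, w`. -/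
def Compatible {n : ℕ} (v w : Equiv.Perm (Fin (n + 2))) : Prop :=
  let t := v.symm (Fin.last (n + 1))
  let t' := w.symm (Fin.last (n + 1))
  let s := v.symm (Fin.last n).castSucc
  let s' := w.symm (Fin.last n).castSucc
  t = t' ∨
    (t' < t ∧ s' ≤ t ∧ t' ≤ s ∧ StrictAntiOn w (Set.Icc t' t) ∧ StrictMonoOn v (Set.Icc t' t))

/-- Membership of `(v, w)` in `𝒯ₙ`: `𝒯₁ = {(id, id)}`, and `(v, w) ∈ 𝒯ₙ₊₁` if the pair is compatible
and the induced pair is in `𝒯ₙ`. (The set is only meant for `n ≥ 1`.) -/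
def InT : {n : ℕ} → Equiv.Perm (Fin n) → Equiv.Perm (Fin n) → Prop
  | 0, _, _ => False
  | 1, v, w => v = 1 ∧ w = 1
  | _ + 2, v, w => InT (induced v) (induced w) ∧ Compatible v w

/-! ### Initial ideals for a weight, restrictions of ideals, toric ideals -/

variable {K σ : Type*} [Field K]

/-- The lowest weight of a monomial that occurs in `f` (`0` for `f = 0`). -/
def lowestWeight (ω : σ → ℕ) (f : MvPolynomial σ K) : ℕ :=
  sInf {m : ℕ | ∃ d ∈ f.support, Finsupp.weight ω d = m}

/-- The initial form of `f`: the sum of all terms of `f` of lowest weight. -/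
def initialForm (ω : σ → ℕ) (f : MvPolynomial σ K) : MvPolynomial σ K :=
  weightedHomogeneousComponent ω (lowestWeight ω f) f

/-- The initial ideal of `I`, generated by the initial forms of all elements of `I`. -/
def initialIdeal (ω : σ → ℕ) (I : Ideal (MvPolynomial σ K)) : Ideal (MvPolynomial σ K) :=
  Ideal.span (initialForm ω '' (I : Set (MvPolynomial σ K)))

/-- The restriction of the ideal `I` to the variables in `T`: the ideal of `K[P_J : J ∈ T]`
generated by the polynomials obtained from those of `I` by setting the variables outside `T`
to zero. -/
def restrictIdeal (T : Set σ) (I : Ideal (MvPolynomial σ K)) : Ideal (MvPolynomial T K) :=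
  Ideal.map (killCompl (Subtype.val_injective : Function.Injective ((↑) : T → σ))) I

/-- The ideal contains no monomial. -/
def IsMonomialFree (I : Ideal (MvPolynomial σ K)) : Prop :=
  ∀ d : σ →₀ ℕ, monomial d (1 : K) ∉ I

/-- A toric ideal: a prime ideal generated by binomials (differences of two monomials). -/
def IsToric (I : Ideal (MvPolynomial σ K)) : Prop :=
  I.IsPrime ∧ ∃ S : Set ((σ →₀ ℕ) × (σ →₀ ℕ)),
    I = Ideal.span ((fun p => monomial p.1 (1 : K) - monomial p.2 1) '' S)

end

/-! ### The flag Plücker ideal and its diagonal initial ideal -/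

/-- The indices of the Plücker variables: the subsets `∅ ≠ J ⊊ [n]`. -/
abbrev PluckerIndex (n : ℕ) : Type :=
  {J : Finset (Fin n) // J.Nonempty ∧ J ≠ Finset.univ}

theorem PluckerIndex.card_le {n : ℕ} (J : PluckerIndex n) : J.1.card ≤ n - 1 := by
  have h : J.1.card < Fintype.card (Fin n) := (Finset.card_lt_iff_ne_univ _).2 J.2.2
  rw [Fintype.card_fin] at h
  omega

noncomputable section

/-- The Plücker form of `J`: the minor of the `(n - 1) × n` matrix of variables `x_{i,j}` with row
indices `1, …, |J|` and column indices in `J`. -/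
def pluckerForm (K : Type*) [Field K] {n : ℕ} (J : PluckerIndex n) :
    MvPolynomial (Fin (n - 1) × Fin n) K :=
  Matrix.det (Matrix.of fun a b : Fin J.1.card =>
    (X (Fin.castLE J.card_le a, J.1.orderEmbOfFin rfl b) :
      MvPolynomial (Fin (n - 1) × Fin n) K))

/-- The flag Plücker ideal `Iₙ`, the kernel of the map sending each Plücker variable to its
Plücker form. -/
def pluckerIdeal (K : Type*) [Field K] (n : ℕ) : Ideal (MvPolynomial (PluckerIndex n) K) :=
  RingHom.ker (aeval (R := K) fun J : PluckerIndex n => pluckerForm K J)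

/-- The weight matrix with entries `(i - 1) (n - j + 1)` for `1 ≤ i ≤ n - 1` and `1 ≤ j ≤ n`;
in the shifted indices this is `i (n - j)`, with `j < n`. -/
def diagWeight (n : ℕ) (p : Fin (n - 1) × Fin n) : ℕ :=
  (p.1 : ℕ) * (n - (p.2 : ℕ))

/-- The initial term of the Plücker form of `J` for the weight matrix. -/
def initialTerm (K : Type*) [Field K] {n : ℕ} (J : PluckerIndex n) :
    MvPolynomial (Fin (n - 1) × Fin n) K :=
  initialForm (diagWeight n) (pluckerForm K J)

/-- The weight vector on the Plücker variables induced by the weight matrix: `P_J` has the weight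
of the initial term of its Plücker form, that is, the lowest weight occurring in that form. -/
def pluckerWeight (K : Type*) [Field K] {n : ℕ} (J : PluckerIndex n) : ℕ :=
  lowestWeight (diagWeight n) (pluckerForm K J)

/-- The initial ideal `in(Iₙ)` of the flag Plücker ideal for the induced weight vector. -/
def initialPluckerIdeal (K : Type*) [Field K] (n : ℕ) :
    Ideal (MvPolynomial (PluckerIndex n) K) :=
  initialIdeal (pluckerWeight K) (pluckerIdeal K n)

/-- The index set `T_w^v` of all `J` with `v ≤ J ≤ w`, that is,
`{v₁, …, v_{|J|}} ≤ J ≤ {w₁, …, w_{|J|}}`. -/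
def richardsonSet {n : ℕ} (v w : Equiv.Perm (Fin n)) : Set (PluckerIndex n) :=
  {J | SubsetLE (firstValues v J.1.card) J.1 ∧ SubsetLE J.1 (firstValues w J.1.card)}

/-- The restricted monomial map from `K[P_J : J ∈ T_w^v]` to `K[x_{i,j}]`, sending `P_J` to the
initial term of its Plücker form. -/
def restrictedMonomialMap (K : Type*) [Field K] {n : ℕ} (v w : Equiv.Perm (Fin n)) :
    MvPolynomial (richardsonSet v w) K →ₐ[K] MvPolynomial (Fin (n - 1) × Fin n) K :=
  aeval fun J : richardsonSet v w => initialTerm K J.1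

end

end FlagRichardson

/-!
A subset `J` of `[n]` is encoded by its lattice path `height J`, which goes up at the elements of
`J`. The order on subsets is the reversed pointwise order of paths (`subsetLE_iff_height`), and the
diagonal term of the Plücker form of `J` records the up-steps of the path. Two monomials in the
Plücker variables thus have the same product of diagonal terms exactly when their families of paths
use every step equally often (`exists_mem_support_same_step`), and any two such families are
connected by tail swaps: two paths through a common point exchange their continuations
(`monomial_sub_monomial_mem_of_tailSwap`).

*The initial ideal.* By the rearrangement inequality the initial term of a Plücker form is its
diagonal term (`initialTerm_eq`), so the initial ideal lies in the kernel of the map to diagonal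
terms. Conversely, this kernel is generated by binomials of monomials with equal image, hence by the
tail swap binomials `P_A P_B - P_A' P_B'`, and these are initial forms of relations: both products
straighten to combinations of products with comparable indices
(`pluckerForm_mul_mem_standardSpan`), whose leading terms are distinct (`injOn_totalExponent`), so
that in the difference only products of higher weight remain (`binomial_mem_initialIdeal`).
Straightening of two factors follows from an exchange relation, the vanishing of alternating maps in
`k + 1` vectors of a free module of rank `k` (`mul_mem_of_exchange`). Together this gives
`initialPluckerIdeal_eq_ker`.

*Restriction.* If a tail swap of two members of `T = richardsonSet v w` leaves `T`, its binomial
restricts to a monomial. If `T` is closed under tail swaps, every path made of steps of paths in `T`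
is in `T`, so a binomial of the initial ideal restricts to a binomial or to zero, and the
restricted ideal is the kernel of the restricted monomial map (`restrictIdeal_eq_ker`). Such a
kernel is prime, generated by binomials, and contains no monomial.

*Combinatorics.* It remains to see that `T` is closed under tail swaps exactly for the pairs of
`𝒯ₙ`. Comparing extremal paths through a point turns closedness into a condition on the rank
functions of `v` and `w` (`RankCondition`). When the largest entries, in positions `t` of `v` and
`t'` of `w`, are deleted, the condition changes only at positions between `t'` and `t`, where for
pairs in Bruhat order it forces the entries of `v` to exceed all earlier ones and those of `w` to
exceed all later ones. This is what compatibility amounts to (`rankCondition_and_rank_le_iff`).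
-/

namespace FlagRichardson

open MvPolynomial

/-! ### Lattice paths of subsets -/

/-- The number of elements of `J` below `m`. The function `height J` is the lattice path of `J`:
it goes up at step `m` if `m ∈ J` and stays level otherwise. -/
def height {n : ℕ} (J : Finset (Fin n)) (m : ℕ) : ℕ :=
  (J.filter fun x : Fin n => (x : ℕ) < m).card

section height

variable {n : ℕ}

theorem height_zero (J : Finset (Fin n)) : height J 0 = 0 := by
  simp [height]

theorem height_of_le (J : Finset (Fin n)) {m : ℕ} (hm : n ≤ m) : height J m = J.card := by
  unfold height
  rw [Finset.filter_true_of_mem]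
  intro x _
  omega

theorem height_mono (J : Finset (Fin n)) : Monotone (height J) := by
  intro a b hab
  apply Finset.card_le_card
  intro x
  simp only [Finset.mem_filter]
  exact fun h => ⟨h.1, by omega⟩

theorem height_le_card (J : Finset (Fin n)) (m : ℕ) : height J m ≤ J.card :=
  Finset.card_filter_le _ _

theorem height_succ (J : Finset (Fin n)) (x : Fin n) :
    height J (x + 1) = height J x + if x ∈ J then 1 else 0 := by
  unfold height
  split_ifs with hx
  · rw [← Finset.card_insert_of_notMem (a := x) (by simp)]
    congr 1
    ext y
    simp only [Finset.mem_filter, Finset.mem_insert]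
    constructor
    · rintro ⟨hy, hlt⟩
      rcases Nat.lt_succ_iff_lt_or_eq.1 hlt with h | h
      · exact Or.inr ⟨hy, h⟩
      · exact Or.inl (Fin.ext h)
    · rintro (rfl | ⟨hy, hlt⟩)
      · exact ⟨hx, by omega⟩
      · exact ⟨hy, by omega⟩
  · rw [add_zero]
    congr 1
    ext y
    simp only [Finset.mem_filter]
    refine and_congr_right fun hy => ?_
    have : (y : ℕ) ≠ x := fun h => hx (Fin.ext h ▸ hy)
    omega

theorem height_succ_le (J : Finset (Fin n)) (m : ℕ) : height J (m + 1) ≤ height J m + 1 := by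
  rcases lt_or_ge m n with h | h
  · have := height_succ J ⟨m, h⟩
    simp only at this
    rw [this]
    split_ifs <;> omega
  · rw [height_of_le J h, height_of_le J (by omega)]
    omega

theorem height_le_add (J : Finset (Fin n)) {p m : ℕ} (h : p ≤ m) :
    height J m ≤ height J p + (m - p) := by
  obtain ⟨d, rfl⟩ := Nat.exists_eq_add_of_le h
  induction d with
  | zero => simp
  | succ d ih =>
    have := height_succ_le J (p + d)
    have := ih (by omega)
    rw [← add_assoc]
    omega

/-- A subset is determined by its lattice path. -/
theorem height_injective : Function.Injective (height : Finset (Fin n) → ℕ → ℕ) := by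
  intro I J h
  ext x
  have h1 := height_succ I x
  rw [h, height_succ J x] at h1
  by_cases hI : x ∈ I <;> by_cases hJ : x ∈ J <;> simp_all

/-- Every function with steps `0` and `1` starting at `0` is the lattice path of a subset. -/
theorem exists_height_eq (f : ℕ → ℕ) (h0 : f 0 = 0) (h1 : ∀ p, f p ≤ f (p + 1))
    (h2 : ∀ p, f (p + 1) ≤ f p + 1) :
    ∃ J : Finset (Fin n), ∀ p ≤ n, height J p = f p := by
  classical
  refine ⟨Finset.univ.filter fun x : Fin n => f x < f (x + 1), fun p => ?_⟩
  induction p with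
  | zero => intro _; rw [height_zero, h0]
  | succ p ih =>
    intro hp
    have hs := height_succ (Finset.univ.filter fun x : Fin n => f x < f (x + 1)) ⟨p, hp⟩
    simp only [Finset.mem_filter, Finset.mem_univ, true_and] at hs
    rw [hs, ih (by omega)]
    have := h1 p
    have := h2 p
    split_ifs <;> omega

theorem height_orderEmbOfFin (J : Finset (Fin n)) (r : Fin J.card) :
    height J (J.orderEmbOfFin rfl r) = r := by
  have : J.filter (fun x : Fin n => (x : ℕ) < J.orderEmbOfFin rfl r) =
      (Finset.Iio r).map (J.orderEmbOfFin rfl).toEmbedding := by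
    ext x
    simp only [Finset.mem_filter, Finset.mem_map, Finset.mem_Iio]
    constructor
    · rintro ⟨hx, hlt⟩
      have : x ∈ Set.range (J.orderEmbOfFin rfl) := by
        rw [Finset.range_orderEmbOfFin]
        exact hx
      obtain ⟨s, rfl⟩ := this
      exact ⟨s, (J.orderEmbOfFin rfl).lt_iff_lt.1 hlt, rfl⟩
    · rintro ⟨s, hs, rfl⟩
      exact ⟨Finset.orderEmbOfFin_mem _ _ _, (J.orderEmbOfFin rfl).lt_iff_lt.2 hs⟩
  rw [height, this, Finset.card_map, Fin.card_Iio]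

theorem orderEmbOfFin_lt_iff (J : Finset (Fin n)) (r : Fin J.card) (m : ℕ) :
    (J.orderEmbOfFin rfl r : ℕ) < m ↔ (r : ℕ) < height J m := by
  have hr := height_orderEmbOfFin J r
  constructor
  · intro h
    have h1 := height_succ J (J.orderEmbOfFin rfl r)
    rw [if_pos (Finset.orderEmbOfFin_mem _ _ _), hr] at h1
    have := height_mono J (show (J.orderEmbOfFin rfl r : ℕ) + 1 ≤ m from h)
    omega
  · intro h
    by_contra hlt
    have := height_mono J (not_lt.1 hlt)
    omega

/-- The order on subsets is the reversed pointwise order of lattice paths. -/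
theorem subsetLE_iff_height (I J : Finset (Fin n)) :
    SubsetLE I J ↔ ∀ m, height J m ≤ height I m := by
  constructor
  · rintro ⟨h, hr⟩ m
    by_contra hlt
    rw [not_le] at hlt
    have h2 : height I m < J.card := hlt.trans_le (height_le_card J m)
    have h3 := (orderEmbOfFin_lt_iff J ⟨_, h2⟩ m).2 hlt
    have h4 := (orderEmbOfFin_lt_iff I (Fin.castLE h ⟨_, h2⟩) m).1
      (lt_of_le_of_lt (hr ⟨_, h2⟩) h3)
    simp at h4
  · intro h
    have hc : J.card ≤ I.card := by
      simpa [height_of_le] using h n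
    refine ⟨hc, fun r => ?_⟩
    have h1 := (orderEmbOfFin_lt_iff J r (J.orderEmbOfFin rfl r + 1)).1 (Nat.lt_succ_self _)
    have h2 := (orderEmbOfFin_lt_iff I (Fin.castLE hc r) _).2 (h1.trans_le (h _))
    exact Nat.lt_succ_iff.1 h2

end height

/-! ### Rank functions of permutations -/

/-- The rank function of `w`: the number of positions `i < k` whose entry is below `m`. -/
def rank {n : ℕ} (w : Equiv.Perm (Fin n)) (k m : ℕ) : ℕ :=
  (Finset.univ.filter fun i : Fin n => (i : ℕ) < k ∧ (w i : ℕ) < m).card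

section rank

variable {n : ℕ} (w : Equiv.Perm (Fin n))

theorem height_firstValues (k m : ℕ) : height (firstValues w k) m = rank w k m := by
  unfold height firstValues rank
  rw [Finset.filter_image, Finset.card_image_of_injective _ w.injective, Finset.filter_filter]

theorem card_firstValues {k : ℕ} (hk : k ≤ n) : (firstValues w k).card = k := by
  unfold firstValues
  rw [Finset.card_image_of_injective _ w.injective, Fin.card_filter_val_lt, min_eq_right hk]

theorem rank_zero_right (k : ℕ) : rank w k 0 = 0 := by
  simp [rank]

theorem rank_zero_left (m : ℕ) : rank w 0 m = 0 := by
  simp [rank]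

theorem rank_of_le {k m : ℕ} (hk : k ≤ n) (hm : n ≤ m) : rank w k m = k := by
  rw [← height_firstValues, height_of_le _ hm, card_firstValues w hk]

theorem rank_mono_left {k l : ℕ} (h : k ≤ l) (m : ℕ) : rank w k m ≤ rank w l m := by
  apply Finset.card_le_card
  intro i
  simp only [Finset.mem_filter, Finset.mem_univ, true_and]
  omega

theorem rank_mono_right (k : ℕ) {p m : ℕ} (h : p ≤ m) : rank w k p ≤ rank w k m := by
  simpa only [height_firstValues] using height_mono (firstValues w k) h

theorem rank_succ_right_le (k m : ℕ) : rank w k (m + 1) ≤ rank w k m + 1 := by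
  simpa only [height_firstValues] using height_succ_le (firstValues w k) m

theorem rank_le_add (k : ℕ) {p m : ℕ} (h : p ≤ m) : rank w k m ≤ rank w k p + (m - p) := by
  simpa only [height_firstValues] using height_le_add (firstValues w k) h

theorem rank_succ_left (l : Fin n) (m : ℕ) :
    rank w (l + 1) m = rank w l m + if (w l : ℕ) < m then 1 else 0 := by
  unfold rank
  split_ifs with hx
  · rw [← Finset.card_insert_of_notMem (a := l) (by simp)]
    congr 1
    ext y
    simp only [Finset.mem_filter, Finset.mem_insert, Finset.mem_univ, true_and]
    constructor
    · rintro ⟨hlt, hy⟩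
      rcases Nat.lt_succ_iff_lt_or_eq.1 hlt with h | h
      · exact Or.inr ⟨h, hy⟩
      · exact Or.inl (Fin.ext h)
    · rintro (rfl | ⟨hlt, hy⟩)
      · exact ⟨by omega, hx⟩
      · exact ⟨by omega, hy⟩
  · rw [add_zero]
    congr 1
    ext y
    simp only [Finset.mem_filter, Finset.mem_univ, true_and]
    refine and_congr_left fun hy => ?_
    have : (y : ℕ) ≠ l := fun h => hx (Fin.ext h ▸ hy)
    omega

theorem rank_left_of_le {k : ℕ} (hk : n ≤ k) (m : ℕ) : rank w k m = rank w n m := by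
  unfold rank
  congr 1
  ext y
  simp only [Finset.mem_filter, Finset.mem_univ, true_and]
  omega

theorem rank_self_left {m : ℕ} (hm : m ≤ n) : rank w n m = m := by
  have h1 := rank_le_add w n hm
  have h2 := rank_le_add w n (Nat.zero_le m)
  rw [rank_of_le w le_rfl le_rfl] at h1
  rw [rank_zero_right] at h2
  omega

/-- A value in `[p, m)` at a position `j < l` makes the rank jump. -/
theorem rank_lt_rank_of_mem {l p m : ℕ} (j : Fin n) (hj : (j : ℕ) < l) (hp : p ≤ w j)
    (hm : (w j : ℕ) < m) : rank w l p < rank w l m := by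
  apply Finset.card_lt_card
  rw [Finset.ssubset_iff_of_subset]
  · exact ⟨j, by simp [hj, hm], by simp; omega⟩
  · intro i
    simp only [Finset.mem_filter, Finset.mem_univ, true_and]
    omega

theorem exists_of_rank_lt_rank_right {l p m : ℕ} (h : rank w l p < rank w l m) :
    ∃ j : Fin n, (j : ℕ) < l ∧ p ≤ w j ∧ (w j : ℕ) < m := by
  by_contra hcon
  push Not at hcon
  refine h.not_ge (Finset.card_le_card fun i => ?_)
  simp only [Finset.mem_filter, Finset.mem_univ, true_and]
  rintro ⟨h1, h2⟩
  refine ⟨h1, ?_⟩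
  by_contra h3
  have := hcon i h1 (not_lt.1 h3)
  omega

theorem exists_of_rank_lt_rank_left {l k p : ℕ} (h : rank w l p < rank w k p) :
    ∃ i : Fin n, l ≤ i ∧ (i : ℕ) < k ∧ (w i : ℕ) < p := by
  by_contra hcon
  push Not at hcon
  refine h.not_ge (Finset.card_le_card fun i => ?_)
  simp only [Finset.mem_filter, Finset.mem_univ, true_and]
  rintro ⟨h1, h2⟩
  refine ⟨?_, h2⟩
  by_contra h3
  have := hcon i (not_lt.1 h3) h1
  omega

/-- A value in `[p, m)` at a position `j ≥ l` keeps the rank from growing at full speed. -/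
theorem rank_lt_add_of_mem {l p m : ℕ} (j : Fin n) (hj : l ≤ j) (hp : p ≤ w j)
    (hm : (w j : ℕ) < m) : rank w l m < rank w l p + (m - p) := by
  have h1 := rank_le_add w l hp
  have h2 := rank_le_add w l (show (w j : ℕ) + 1 ≤ m from hm)
  have h3 : rank w l (w j + 1) ≤ rank w l (w j) := by
    apply Finset.card_le_card
    intro i
    simp only [Finset.mem_filter, Finset.mem_univ, true_and]
    rintro ⟨h4, h5⟩
    refine ⟨h4, ?_⟩
    have : (w i : ℕ) ≠ w j := by
      intro h
      have := w.injective (Fin.ext h)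
      subst this
      omega
    omega
  omega

theorem exists_of_rank_lt_add {l p m : ℕ} (hpm : p ≤ m) (hmn : m ≤ n)
    (h : rank w l m < rank w l p + (m - p)) :
    ∃ j : Fin n, l ≤ j ∧ p ≤ w j ∧ (w j : ℕ) < m := by
  by_contra hcon
  push Not at hcon
  obtain ⟨d, rfl⟩ := Nat.exists_eq_add_of_le hpm
  have key : ∀ e ≤ d, rank w l p + e ≤ rank w l (p + e) := by
    intro e
    induction e with
    | zero => simp
    | succ e ih =>
      intro he
      have h1 := ih (by omega)
      set j := w.symm ⟨p + e, by omega⟩ with hjdef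
      have hj : (w j : ℕ) = p + e := by simp [hjdef]
      have hjl : (j : ℕ) < l := by
        by_contra h3
        have := hcon j (not_lt.1 h3) (by omega)
        omega
      have h4 := rank_lt_rank_of_mem w (l := l) (p := p + e) (m := p + (e + 1)) j hjl
        (by omega) (by omega)
      omega
  have := key d le_rfl
  omega

end rank

section order

variable {n : ℕ}

theorem bruhatLE_iff_rank (v w : Equiv.Perm (Fin n)) :
    BruhatLE v w ↔ ∀ k m, rank w k m ≤ rank v k m := by
  unfold BruhatLE
  simp only [subsetLE_iff_height, height_firstValues, Finset.mem_Icc]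
  constructor
  · intro h k m
    rcases Nat.eq_zero_or_pos k with rfl | hk
    · rw [rank_zero_left, rank_zero_left]
    rcases Nat.eq_zero_or_pos n with rfl | hn
    · simp [rank]
    rcases le_total k n with hkn | hkn
    · exact h k ⟨hk, hkn⟩ m
    · rw [rank_left_of_le w hkn, rank_left_of_le v hkn]
      exact h n ⟨hn, le_rfl⟩ m
  · exact fun h k _ m => h k m

theorem mem_richardsonSet_iff (v w : Equiv.Perm (Fin n)) (J : PluckerIndex n) :
    J ∈ richardsonSet v w ↔
      ∀ m, rank w J.1.card m ≤ height J.1 m ∧ height J.1 m ≤ rank v J.1.card m := by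
  simp only [richardsonSet, Set.mem_ofPred_eq, subsetLE_iff_height, height_firstValues,
    ← forall_and]
  exact forall_congr' fun m => and_comm

end order

/-! ### Exponents of diagonal terms and path counts -/

/-- The exponent of the diagonal term `∏ᵣ x_{r, jᵣ}` of the Plücker form of `J = {j₀ < j₁ < ⋯}`:
the variable `x_{i, j}` occurs if and only if the lattice path of `J` goes up at step `j` from
height `i`. -/
noncomputable def diagExponent {n : ℕ} (J : Finset (Fin n)) : Fin (n - 1) × Fin n →₀ ℕ :=
  Finsupp.equivFunOnFinite.symm fun p => if p.2 ∈ J ∧ height J p.2 = p.1 then 1 else 0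

/-- The exponent of the product of the diagonal terms of the factors of a monomial in the Plücker
variables. -/
noncomputable def totalExponent (n : ℕ) :
    (PluckerIndex n →₀ ℕ) →ₗ[ℕ] (Fin (n - 1) × Fin n →₀ ℕ) :=
  Finsupp.linearCombination ℕ fun J => diagExponent J.1

section counts

variable {n : ℕ}

@[simp]
theorem diagExponent_apply (J : Finset (Fin n)) (p : Fin (n - 1) × Fin n) :
    diagExponent J p = if p.2 ∈ J ∧ height J p.2 = p.1 then 1 else 0 := rfl

theorem totalExponent_single (J : PluckerIndex n) :
    totalExponent n (Finsupp.single J 1) = diagExponent J.1 := by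
  simp [totalExponent]

/-- The number of lattice paths of factors of `M` through the point `(m, h)`. -/
def pathCount (M : PluckerIndex n →₀ ℕ) (m h : ℕ) : ℕ :=
  ∑ J, M J * if height J.1 m = h then 1 else 0

/-- The number of lattice paths of factors of `M` that go up at step `j` from height `h`. -/
def upCount (M : PluckerIndex n →₀ ℕ) (j : Fin n) (h : ℕ) : ℕ :=
  ∑ J, M J * if j ∈ J.1 ∧ height J.1 j = h then 1 else 0

theorem totalExponent_apply (M : PluckerIndex n →₀ ℕ) (i : Fin (n - 1)) (j : Fin n) :
    totalExponent n M (i, j) = upCount M j i := by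
  unfold totalExponent upCount
  rw [Finsupp.linearCombination_apply, Finsupp.sum_fintype _ _ (by simp)]
  simp [Finsupp.finsetSum_apply]

theorem height_lt_of_mem {J : Finset (Fin n)} {j : Fin n} (h : j ∈ J) :
    height J j < J.card := by
  have := height_succ J j
  rw [if_pos h] at this
  have := height_le_card J (j + 1)
  omega

theorem upCount_eq_zero (M : PluckerIndex n →₀ ℕ) (j : Fin n) {h : ℕ} (hh : n - 1 ≤ h) :
    upCount M j h = 0 := by
  refine Finset.sum_eq_zero fun J _ => ?_
  rw [if_neg, mul_zero]
  rintro ⟨h1, h2⟩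
  have := height_lt_of_mem h1
  have := J.card_le
  omega

theorem pathCount_succ_zero (M : PluckerIndex n →₀ ℕ) (j : Fin n) :
    pathCount M (j + 1) 0 + upCount M j 0 = pathCount M j 0 := by
  unfold pathCount upCount
  rw [← Finset.sum_add_distrib]
  refine Finset.sum_congr rfl fun J _ => ?_
  rw [← mul_add, height_succ]
  congr 1
  by_cases h : j ∈ J.1 <;> simp [h]

theorem pathCount_succ_succ (M : PluckerIndex n →₀ ℕ) (j : Fin n) (h : ℕ) :
    pathCount M (j + 1) (h + 1) + upCount M j (h + 1) =
      pathCount M j (h + 1) + upCount M j h := by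
  unfold pathCount upCount
  rw [← Finset.sum_add_distrib, ← Finset.sum_add_distrib]
  refine Finset.sum_congr rfl fun J _ => ?_
  rw [← mul_add, ← mul_add, height_succ]
  congr 1
  by_cases h : j ∈ J.1
  · simp [h, add_comm]
  · simp [h]

theorem upCount_congr {M N : PluckerIndex n →₀ ℕ} (h : totalExponent n M = totalExponent n N)
    (j : Fin n) (i : ℕ) : upCount M j i = upCount N j i := by
  rcases lt_or_ge i (n - 1) with hi | hi
  · have := congrArg (fun e => e (⟨i, hi⟩, j)) h
    simpa only [totalExponent_apply] using this
  · rw [upCount_eq_zero _ _ hi, upCount_eq_zero _ _ hi]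

theorem pathCount_self_zero (M : PluckerIndex n →₀ ℕ) : pathCount M n 0 = 0 := by
  refine Finset.sum_eq_zero fun J _ => ?_
  rw [if_neg, mul_zero]
  rw [height_of_le _ le_rfl, Finset.card_eq_zero]
  exact J.2.1.ne_empty

theorem pathCount_zero_succ (M : PluckerIndex n →₀ ℕ) (h : ℕ) : pathCount M 0 (h + 1) = 0 := by
  refine Finset.sum_eq_zero fun J _ => ?_
  rw [if_neg, mul_zero]
  rw [height_zero]
  omega

/-- The total exponent determines how many lattice paths pass through a given point. At positive
heights this follows by conservation of flow from the left, where all paths start at height `0`;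
at height `0` it follows from the right, since no path ends there. -/
theorem pathCount_congr {M N : PluckerIndex n →₀ ℕ} (h : totalExponent n M = totalExponent n N)
    {m : ℕ} (hm : m ≤ n) (i : ℕ) : pathCount M m i = pathCount N m i := by
  cases i with
  | zero =>
    induction hm using Nat.decreasingInduction with
    | self => rw [pathCount_self_zero, pathCount_self_zero]
    | of_succ k hk ih =>
      have h1 := pathCount_succ_zero M ⟨k, hk⟩
      have h2 := pathCount_succ_zero N ⟨k, hk⟩
      simp only [upCount_congr h] at h1 h2
      omega
  | succ i =>
    induction m generalizing i with
    | zero => rw [pathCount_zero_succ, pathCount_zero_succ]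
    | succ m ih =>
      have h1 := pathCount_succ_succ M ⟨m, hm⟩ i
      have h2 := pathCount_succ_succ N ⟨m, hm⟩ i
      have h3 := ih (by omega) i
      simp only [upCount_congr h] at h1 h2
      omega

/-- If two monomials have the same total exponent, each step of a path of a factor of one is also a
step of a path of a factor of the other. -/
theorem exists_mem_support_same_step {M N : PluckerIndex n →₀ ℕ}
    (h : totalExponent n M = totalExponent n N) {J : PluckerIndex n} (hJ : J ∈ N.support)
    (m : Fin n) : ∃ B ∈ M.support, height B.1 m = height J.1 m ∧ (m ∈ B.1 ↔ m ∈ J.1) := by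
  have hpos : 0 < N J := Nat.pos_of_ne_zero (Finsupp.mem_support_iff.1 hJ)
  by_cases hm : m ∈ J.1
  · have h1 : 0 < upCount N m (height J.1 m) :=
      Finset.sum_pos' (fun _ _ => Nat.zero_le _) ⟨J, Finset.mem_univ _, by simp [hm, hpos]⟩
    rw [← upCount_congr h] at h1
    obtain ⟨B, -, hB⟩ := Finset.exists_ne_zero_of_sum_ne_zero h1.ne'
    have hB2 : m ∈ B.1 ∧ height B.1 m = height J.1 m := by
      by_contra hcon
      simp [hcon] at hB
    refine ⟨B, Finsupp.mem_support_iff.2 fun h0 => hB (by simp [h0]), hB2.2, ?_⟩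
    simp [hm, hB2.1]
  · have h1 : upCount N m (height J.1 m) < pathCount N m (height J.1 m) := by
      refine Finset.sum_lt_sum (fun I _ => Nat.mul_le_mul_left _ ?_)
        ⟨J, Finset.mem_univ _, by simp [hm, hpos]⟩
      split_ifs <;> simp_all
    rw [← upCount_congr h, ← pathCount_congr h m.2.le] at h1
    obtain ⟨B, -, hB⟩ := Finset.exists_lt_of_sum_lt h1
    refine ⟨B, Finsupp.mem_support_iff.2 fun h0 => by simp [h0] at hB, ?_⟩
    by_cases h2 : height B.1 m = height J.1 m
    · refine ⟨h2, ?_⟩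
      simp only [hm, iff_false]
      intro h3
      simp [h2, h3] at hB
    · simp [h2] at hB

theorem exists_mem_support {M N : PluckerIndex n →₀ ℕ}
    (h : totalExponent n M = totalExponent n N) {J : PluckerIndex n} (hJ : J ∈ N.support) :
    ∃ B, B ∈ M.support := by
  obtain ⟨x, -⟩ := J.2.1
  obtain ⟨B, hB, -⟩ := exists_mem_support_same_step h hJ x
  exact ⟨B, hB⟩

end counts

/-! ### Tail swaps -/

/-- The subset that agrees with `A` below `m` and with `B` from `m` on. -/
def tailSwap {n : ℕ} (A B : Finset (Fin n)) (m : ℕ) : Finset (Fin n) :=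
  Finset.univ.filter fun x => if (x : ℕ) < m then x ∈ A else x ∈ B

section tailSwap

variable {n : ℕ}

theorem mem_tailSwap {A B : Finset (Fin n)} {m : ℕ} {x : Fin n} :
    x ∈ tailSwap A B m ↔ if (x : ℕ) < m then x ∈ A else x ∈ B := by
  simp [tailSwap]

theorem mem_tailSwap_of_lt {A B : Finset (Fin n)} {m : ℕ} {x : Fin n} (hx : (x : ℕ) < m) :
    x ∈ tailSwap A B m ↔ x ∈ A := by
  rw [mem_tailSwap, if_pos hx]

theorem mem_tailSwap_of_le {A B : Finset (Fin n)} {m : ℕ} {x : Fin n} (hx : m ≤ x) :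
    x ∈ tailSwap A B m ↔ x ∈ B := by
  rw [mem_tailSwap, if_neg hx.not_gt]

theorem height_congr {A B : Finset (Fin n)} {p : ℕ}
    (h : ∀ x : Fin n, (x : ℕ) < p → (x ∈ A ↔ x ∈ B)) : height A p = height B p := by
  unfold height
  congr 1
  ext x
  simp only [Finset.mem_filter]
  exact ⟨fun hx => ⟨(h x hx.2).1 hx.1, hx.2⟩, fun hx => ⟨(h x hx.2).2 hx.1, hx.2⟩⟩

theorem height_tailSwap_of_le (A B : Finset (Fin n)) {m p : ℕ} (hp : p ≤ m) :
    height (tailSwap A B m) p = height A p :=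
  height_congr fun _ hx => mem_tailSwap_of_lt (hx.trans_le hp)

theorem height_tailSwap_of_ge {A B : Finset (Fin n)} {m : ℕ} (h : height A m = height B m) {p : ℕ}
    (hp : m ≤ p) : height (tailSwap A B m) p = height B p := by
  obtain ⟨d, rfl⟩ := Nat.exists_eq_add_of_le hp
  induction d with
  | zero => rw [add_zero, height_tailSwap_of_le A B le_rfl, h]
  | succ d ih =>
    rcases lt_or_ge (m + d) n with hd | hd
    · have h1 := height_succ (tailSwap A B m) ⟨m + d, hd⟩
      have h2 := height_succ B ⟨m + d, hd⟩
      rw [if_congr (mem_tailSwap_of_le (by simp)) rfl rfl] at h1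
      rw [← add_assoc, h1, h2, ih (by omega)]
    · have h3 := ih (by omega)
      rw [height_of_le _ hd, height_of_le _ hd] at h3
      rw [height_of_le _ (by omega), height_of_le _ (by omega), h3]

theorem card_tailSwap {A B : Finset (Fin n)} {m : ℕ} (h : height A m = height B m) :
    (tailSwap A B m).card = B.card := by
  rw [← height_of_le _ (le_max_left n m), ← height_of_le B (le_max_left n m),
    height_tailSwap_of_ge h (le_max_right _ _)]

/-- The tail swap of two Plücker indices whose lattice paths meet at step `m`. -/
def PluckerIndex.tailSwap (A B : PluckerIndex n) (m : ℕ) (h : height A.1 m = height B.1 m) :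
    PluckerIndex n :=
  ⟨FlagRichardson.tailSwap A.1 B.1 m, by
    rw [← Finset.card_pos, card_tailSwap h]
    exact Finset.card_pos.2 B.2.1, by
    rw [← Finset.card_lt_iff_ne_univ, card_tailSwap h, Finset.card_lt_iff_ne_univ]
    exact B.2.2⟩

theorem diagExponent_tailSwap_add {A B : Finset (Fin n)} {m : ℕ} (h : height A m = height B m) :
    diagExponent (tailSwap A B m) + diagExponent (tailSwap B A m) =
      diagExponent A + diagExponent B := by
  ext ⟨i, j⟩
  simp only [Finsupp.add_apply, diagExponent_apply]
  rcases lt_or_ge (j : ℕ) m with hj | hj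
  · simp only [mem_tailSwap_of_lt hj, height_tailSwap_of_le _ _ hj.le]
  · simp only [mem_tailSwap_of_le hj, height_tailSwap_of_ge h hj, height_tailSwap_of_ge h.symm hj]
    exact add_comm _ _

/-- A set of subsets that is closed under swapping the tails of two paths that meet. -/
def SwapClosed (T : Set (PluckerIndex n)) : Prop :=
  ∀ A ∈ T, ∀ B ∈ T, ∀ (m : ℕ) (h : height A.1 m = height B.1 m), A.tailSwap B m h ∈ T

/-- If all factors of `M` are in the swap-closed set `T`, so are the factors of each monomial with
the same total exponent: a path made of steps of paths in `T` is built up by tail swaps. -/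
theorem SwapClosed.mem_of_totalExponent_eq {T : Set (PluckerIndex n)} (hT : SwapClosed T)
    {M N : PluckerIndex n →₀ ℕ} (h : totalExponent n M = totalExponent n N)
    (hM : ∀ J ∈ M.support, J ∈ T) {J : PluckerIndex n} (hJ : J ∈ N.support) : J ∈ T := by
  have key : ∀ m ≤ n, ∃ A ∈ T, ∀ x : Fin n, (x : ℕ) < m → (x ∈ A.1 ↔ x ∈ J.1) := by
    intro m
    induction m with
    | zero =>
      intro _
      obtain ⟨B, hB⟩ := exists_mem_support h hJ
      exact ⟨B, hM B hB, by simp⟩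
    | succ m ih =>
      intro hm
      obtain ⟨A, hA, hAJ⟩ := ih (by omega)
      obtain ⟨B, hB, hB1, hB2⟩ := exists_mem_support_same_step h hJ ⟨m, hm⟩
      have hAB : height A.1 m = height B.1 m := (height_congr hAJ).trans hB1.symm
      refine ⟨A.tailSwap B m hAB, hT A hA B (hM B hB) m hAB, fun x hx => ?_⟩
      rcases Nat.lt_succ_iff_lt_or_eq.1 hx with hx | hx
      · exact (mem_tailSwap_of_lt hx).trans (hAJ x hx)
      · obtain rfl : x = ⟨m, hm⟩ := Fin.ext hx
        exact (mem_tailSwap_of_le le_rfl).trans hB2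
  obtain ⟨A, hA, hAJ⟩ := key n le_rfl
  have : A = J := Subtype.ext (Finset.ext fun x => hAJ x x.2)
  exact this ▸ hA

/-- An ideal that contains all binomials coming from tail swaps contains the difference of any two
monomials with the same total exponent: tail swaps turn a factor of the first monomial into any
given factor of the second, which can then be cancelled. -/
theorem monomial_sub_monomial_mem_of_tailSwap {K : Type*} [Field K]
    (I : Ideal (MvPolynomial (PluckerIndex n) K))
    (hI : ∀ (A B : PluckerIndex n) (m : ℕ) (h : height A.1 m = height B.1 m),
      (X A * X B - X (A.tailSwap B m h) * X (B.tailSwap A m h.symm) :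
        MvPolynomial (PluckerIndex n) K) ∈ I)
    {M N : PluckerIndex n →₀ ℕ} (h : totalExponent n M = totalExponent n N) :
    monomial M (1 : K) - monomial N 1 ∈ I := by
  induction hd : N.degree using Nat.strong_induction_on generalizing M N with
  | _ d ih =>
    rcases eq_or_ne N 0 with rfl | hN
    · have hM : M = 0 := by
        by_contra hM
        obtain ⟨J, hJ⟩ := Finsupp.support_nonempty_iff.2 hM
        obtain ⟨B, hB⟩ := exists_mem_support h.symm hJ
        simp at hB
      simp [hM]
    obtain ⟨J, hJ⟩ := Finsupp.support_nonempty_iff.2 hN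
    have key : ∀ m ≤ n, ∃ M' : PluckerIndex n →₀ ℕ,
        totalExponent n M' = totalExponent n N ∧ monomial M (1 : K) - monomial M' 1 ∈ I ∧
        ∃ A ∈ M'.support, ∀ x : Fin n, (x : ℕ) < m → (x ∈ A.1 ↔ x ∈ J.1) := by
      intro m
      induction m with
      | zero =>
        intro _
        obtain ⟨B, hB⟩ := exists_mem_support h hJ
        exact ⟨M, h, by simp, B, hB, by simp⟩
      | succ m ihm =>
        intro hm
        obtain ⟨M', hM', hI', A, hA, hAJ⟩ := ihm (by omega)
        obtain ⟨B, hB, hB1, hB2⟩ := exists_mem_support_same_step hM' hJ ⟨m, hm⟩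
        have hAB : height A.1 m = height B.1 m := (height_congr hAJ).trans hB1.symm
        by_cases hcase : (⟨m, hm⟩ : Fin n) ∈ A.1 ↔ (⟨m, hm⟩ : Fin n) ∈ J.1
        · refine ⟨M', hM', hI', A, hA, fun x hx => ?_⟩
          rcases Nat.lt_succ_iff_lt_or_eq.1 hx with hx | hx
          · exact hAJ x hx
          · obtain rfl : x = ⟨m, hm⟩ := Fin.ext hx
            exact hcase
        have hne : A ≠ B := fun hAB' => hcase (hAB' ▸ hB2)
        have hle : Finsupp.single A 1 + Finsupp.single B 1 ≤ M' := by
          intro x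
          have h1 : 1 ≤ M' A := Nat.one_le_iff_ne_zero.2 (Finsupp.mem_support_iff.1 hA)
          have h2 : 1 ≤ M' B := Nat.one_le_iff_ne_zero.2 (Finsupp.mem_support_iff.1 hB)
          simp only [Finsupp.add_apply, Finsupp.single_apply]
          split_ifs with h3 h4 h4
          · exact absurd (h3.trans h4.symm) hne
          · simpa [← h3] using h1
          · simpa [← h4] using h2
          · exact Nat.zero_le _
        obtain ⟨M₀, rfl⟩ := exists_add_of_le hle
        refine ⟨Finsupp.single (A.tailSwap B m hAB) 1 +
          Finsupp.single (B.tailSwap A m hAB.symm) 1 + M₀, ?_, ?_, A.tailSwap B m hAB, ?_, ?_⟩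
        · rw [← hM']
          simp only [map_add, totalExponent_single]
          rw [← diagExponent_tailSwap_add hAB]
          rfl
        · have h1 := I.mul_mem_right (monomial M₀ 1) (hI A B m hAB)
          have h2 := I.add_mem hI' h1
          convert h2 using 1
          simp only [X, sub_mul, monomial_mul, one_mul]
          ring
        · simp
        · intro x hx
          rcases Nat.lt_succ_iff_lt_or_eq.1 hx with hx | hx
          · exact (mem_tailSwap_of_lt hx).trans (hAJ x hx)
          · obtain rfl : x = ⟨m, hm⟩ := Fin.ext hx
            exact (mem_tailSwap_of_le le_rfl).trans hB2
    obtain ⟨M', hM', hI', A, hA, hAJ⟩ := key n le_rfl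
    obtain rfl : A = J := Subtype.ext (Finset.ext fun x => hAJ x x.2)
    have hle : ∀ {P : PluckerIndex n →₀ ℕ}, A ∈ P.support → Finsupp.single A 1 ≤ P := fun hP =>
      Finsupp.single_le_iff.2 (Nat.one_le_iff_ne_zero.2 (Finsupp.mem_support_iff.1 hP))
    obtain ⟨M₁, rfl⟩ := exists_add_of_le (hle hA)
    obtain ⟨N₁, rfl⟩ := exists_add_of_le (hle hJ)
    have h3 := ih N₁.degree (by rw [← hd, map_add, Finsupp.degree_single]; omega)
      (M := M₁) (N := N₁) (by simpa using hM') rfl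
    have h4 := I.add_mem hI' (I.mul_mem_left (X A) h3)
    convert h4 using 1
    simp only [X, mul_sub, monomial_mul, one_mul]
    ring

end tailSwap

/-! ### Swap-closed Richardson sets -/

/-- A numerical condition on `(v, w)` equivalent to `richardsonSet v w` being swap-closed.
If `rank w (l + 1) m ≤ rank v l m`, then paths of subsets of sizes `l` and `l + 1` in the Richardson
set can meet at step `m`. The conclusion then excludes that the beginning of a path of one size,
continued by a path of the other size, violates the bounds for that size. -/
def RankCondition {n : ℕ} (v w : Equiv.Perm (Fin n)) : Prop :=
  ∀ (l : Fin n) (m : ℕ), m ≤ n → rank w (l + 1) m ≤ rank v l m →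
    (∀ j < l, v l < v j → m ≤ v j) ∧ ∀ j > l, w l < w j → m ≤ w j

section

variable {n : ℕ} {v w : Equiv.Perm (Fin n)}

theorem exists_pluckerIndex_of_height {k : ℕ} (hk : 0 < k) (hkn : k < n) (f : ℕ → ℕ)
    (h0 : f 0 = 0) (h1 : ∀ p, f p ≤ f (p + 1)) (h2 : ∀ p, f (p + 1) ≤ f p + 1)
    (h3 : ∀ p, rank w k p ≤ f p) (h4 : ∀ p, f p ≤ rank v k p) :
    ∃ J ∈ richardsonSet v w, J.1.card = k ∧ ∀ p ≤ n, height J.1 p = f p := by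
  obtain ⟨J, hJ⟩ := exists_height_eq (n := n) f h0 h1 h2
  have hc : J.card = k := by
    rw [← height_of_le J le_rfl, hJ n le_rfl]
    have := h3 n
    have := h4 n
    rw [rank_of_le _ hkn.le le_rfl] at *
    omega
  refine ⟨⟨J, Finset.card_pos.1 (hc ▸ hk), ?_⟩, ?_, hc, hJ⟩
  · rw [← Finset.card_lt_iff_ne_univ, hc, Fintype.card_fin]
    exact hkn
  · rw [mem_richardsonSet_iff]
    intro m
    simp only [hc]
    rcases le_total m n with hm | hm
    · rw [hJ m hm]
      exact ⟨h3 m, h4 m⟩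
    · rw [height_of_le J hm, rank_of_le _ hkn.le hm, rank_of_le _ hkn.le hm, hc]
      exact ⟨le_rfl, le_rfl⟩

theorem RankCondition.swapClosed (h : RankCondition v w) : SwapClosed (richardsonSet v w) := by
  intro A hA B hB m hm
  -- beyond `n` all paths are level, so the meeting point may be taken to be at most `n`
  wlog hmn : m ≤ n generalizing m
  · have hm' : height A.1 n = height B.1 n := by
      rw [height_of_le _ (by omega), height_of_le _ (by omega)] at hm
      rw [height_of_le _ le_rfl, height_of_le _ le_rfl, hm]
    have heq : A.tailSwap B m hm = A.tailSwap B n hm' := by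
      refine Subtype.ext (Finset.ext fun x => ?_)
      exact (mem_tailSwap_of_lt (by omega)).trans (mem_tailSwap_of_lt x.2).symm
    exact heq ▸ this n hm' le_rfl
  rw [mem_richardsonSet_iff] at hA hB ⊢
  have hc : (A.tailSwap B m hm).1.card = B.1.card := card_tailSwap hm
  intro p
  rw [hc]
  change _ ≤ height (tailSwap A.1 B.1 m) p ∧ height (tailSwap A.1 B.1 m) p ≤ _
  rcases le_total m p with hp | hp
  · rw [height_tailSwap_of_ge hm hp]
    exact hB p
  rw [height_tailSwap_of_le _ _ hp]
  have hAp := hA p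
  have hAm := hA m
  have hBm := hB m
  have hmono := height_mono A.1 hp
  -- the two cardinalities decide which of the bounds is automatic
  rcases le_total B.1.card A.1.card with hle | hle
  · refine ⟨(rank_mono_left w hle p).trans hAp.1, ?_⟩
    by_contra hlt
    obtain ⟨i, hi1, hi2, hi3⟩ := exists_of_rank_lt_rank_left v
      (show rank v B.1.card p < rank v A.1.card p by omega)
    obtain ⟨j, hj1, hj2, hj3⟩ := exists_of_rank_lt_rank_right v
      (show rank v B.1.card p < rank v B.1.card m by omega)
    have := (h i m hmn ?_).1 j (by rw [Fin.lt_def]; omega) (by rw [Fin.lt_def]; omega)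
    · omega
    · have := rank_mono_left w (show (i : ℕ) + 1 ≤ A.1.card from hi2) m
      have := rank_mono_left v hi1 m
      omega
  · refine ⟨?_, hAp.2.trans (rank_mono_left v hle p)⟩
    by_contra hlt
    obtain ⟨i, hi1, hi2, hi3⟩ := exists_of_rank_lt_rank_left w
      (show rank w A.1.card p < rank w B.1.card p by omega)
    have hadd := height_le_add A.1 hp
    obtain ⟨j, hj1, hj2, hj3⟩ := exists_of_rank_lt_add w hp hmn
      (show rank w B.1.card m < rank w B.1.card p + (m - p) by omega)
    have := (h i m hmn ?_).2 j (by rw [gt_iff_lt, Fin.lt_def]; omega)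
      (by rw [Fin.lt_def]; omega)
    · omega
    · have := rank_mono_left w (show (i : ℕ) + 1 ≤ B.1.card from hi2) m
      have := rank_mono_left v hi1 m
      omega

theorem rankCondition_of_swapClosed (hvw : ∀ k m, rank w k m ≤ rank v k m)
    (h : SwapClosed (richardsonSet v w)) : RankCondition v w := by
  intro l m hmn htouch
  constructor
  · intro j hj hlj
    by_contra hjm
    rw [not_le] at hjm
    rw [Fin.lt_def] at hj hlj
    have hvl : rank v (l + 1) m = rank v l m + 1 := by
      rw [rank_succ_left, if_pos (by omega)]
    have hl : (l : ℕ) + 1 < n := by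
      by_contra hl
      have hl : (l : ℕ) + 1 = n := by omega
      rw [hl, rank_self_left _ hmn] at htouch hvl
      omega
    -- the highest path of size `l + 1` through `(m, rank v l m)`
    obtain ⟨A, hA, hAc, hAh⟩ := exists_pluckerIndex_of_height (v := v) (w := w)
      (k := l + 1) (by omega) hl (fun p => min (rank v (l + 1) p) (rank v l m + (p - m)))
      (by simp [rank_zero_right])
      (fun p => by
        have := rank_mono_right v (l + 1) (show p ≤ p + 1 by omega)
        omega)
      (fun p => by
        have := rank_succ_right_le v (l + 1) p
        omega)
      (fun p => by
        have := hvw (l + 1) p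
        have : rank w (l + 1) p ≤ rank v l m + (p - m) := by
          rcases le_total p m with hp | hp
          · have := rank_mono_right w (l + 1) hp
            omega
          · have := rank_le_add w (l + 1) hp
            omega
        omega)
      (fun p => min_le_left _ _)
    -- the highest path of size `l`
    obtain ⟨B, hB, hBc, hBh⟩ := exists_pluckerIndex_of_height (v := v) (w := w)
      (k := l) (by omega) (by omega) (rank v l) (rank_zero_right _ _)
      (fun p => rank_mono_right v l (show p ≤ p + 1 by omega)) (rank_succ_right_le v l) (hvw l)
      (fun p => le_rfl)
    have hm : height A.1 m = height B.1 m := by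
      rw [hAh m hmn, hBh m hmn]
      omega
    have h1 := (mem_richardsonSet_iff _ _ _).1 (h A hA B hB m hm) (v j)
    have hc : (A.tailSwap B m hm).1.card = l := (card_tailSwap hm).trans hBc
    rw [hc] at h1
    have h2 : height (A.tailSwap B m hm).1 (v j) = height A.1 (v j) :=
      height_tailSwap_of_le _ _ hjm.le
    rw [h2, hAh _ (v j).2.le, rank_succ_left, if_pos hlj] at h1
    have h3 := rank_lt_rank_of_mem v (l := l) (p := v j) (m := m) j hj le_rfl hjm
    omega
  · intro j hj hlj
    by_contra hjm
    rw [not_le] at hjm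
    rw [gt_iff_lt, Fin.lt_def] at hj
    rw [Fin.lt_def] at hlj
    have hwl : rank w (l + 1) m = rank w l m + 1 := by
      rw [rank_succ_left, if_pos (by omega)]
    have hl : 0 < (l : ℕ) := by
      by_contra hl
      have hl : (l : ℕ) = 0 := by omega
      have := rank_zero_left v m
      rw [hl] at htouch hwl
      omega
    have hjn := j.2
    -- the lowest path of size `l` through `(m, rank w (l + 1) m)`
    obtain ⟨A, hA, hAc, hAh⟩ := exists_pluckerIndex_of_height (v := v) (w := w)
      (k := l) hl (by omega) (fun p => max (rank w l p) (rank w (l + 1) m - (m - p)))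
      (by
        have := rank_le_add w (l + 1) (Nat.zero_le m)
        simp only [rank_zero_right] at *
        omega)
      (fun p => by
        have := rank_mono_right w l (show p ≤ p + 1 by omega)
        omega)
      (fun p => by
        have := rank_succ_right_le w l p
        omega)
      (fun p => le_max_left _ _)
      (fun p => by
        have := hvw l p
        have : rank w (l + 1) m - (m - p) ≤ rank v l p := by
          rcases le_total p m with hp | hp
          · have := rank_le_add v l hp
            omega
          · have := rank_mono_right v l hp
            omega
        omega)
    -- the lowest path of size `l + 1`
    obtain ⟨B, hB, hBc, hBh⟩ := exists_pluckerIndex_of_height (v := v) (w := w)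
      (k := l + 1) (by omega) (by omega) (rank w (l + 1)) (rank_zero_right _ _)
      (fun p => rank_mono_right w (l + 1) (show p ≤ p + 1 by omega)) (rank_succ_right_le w (l + 1))
      (fun p => le_rfl) (hvw (l + 1))
    have hm : height A.1 m = height B.1 m := by
      rw [hAh m hmn, hBh m hmn]
      omega
    have h1 := (mem_richardsonSet_iff _ _ _).1 (h A hA B hB m hm) (w j)
    have hc : (A.tailSwap B m hm).1.card = l + 1 := (card_tailSwap hm).trans hBc
    rw [hc] at h1
    have h2 : height (A.tailSwap B m hm).1 (w j) = height A.1 (w j) :=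
      height_tailSwap_of_le _ _ hjm.le
    have h3 := rank_lt_add_of_mem w (l := l + 1) (p := w j) (m := m) j hj le_rfl hjm
    rw [h2, hAh _ (w j).2.le] at h1
    have h4 : rank w (l + 1) (w j) = rank w l (w j) + 1 := by
      rw [rank_succ_left, if_pos hlj]
    omega

end

/-! ### Deleting the largest entry -/

/-- The entry of `w` in position `i`, as a function on all natural numbers that is the identity from
`n` on. -/
def entry {n : ℕ} (w : Equiv.Perm (Fin n)) (i : ℕ) : ℕ :=
  if h : i < n then w ⟨i, h⟩ else i

section entry

variable {n : ℕ}

theorem entry_val (w : Equiv.Perm (Fin n)) (i : Fin n) : entry w i = w i := by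
  simp [entry]

theorem entry_lt (w : Equiv.Perm (Fin n)) {i : ℕ} (hi : i < n) : entry w i < n := by
  rw [entry, dif_pos hi]
  exact (w _).2

theorem entry_inj (w : Equiv.Perm (Fin n)) {i j : ℕ} (hi : i < n) (hj : j < n)
    (h : entry w i = entry w j) : i = j := by
  rw [entry, entry, dif_pos hi, dif_pos hj] at h
  exact congrArg Fin.val (w.injective (Fin.ext h))

/-- Entries of `v` before position `l` that exceed the entry in position `l` are at least `m`. -/
def NoLargerBefore (v : Equiv.Perm (Fin n)) (l m : ℕ) : Prop :=
  ∀ j < l, entry v l < entry v j → m ≤ entry v j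

/-- Entries of `w` after position `l` that exceed the entry in position `l` are at least `m`. -/
def NoLargerAfter (w : Equiv.Perm (Fin n)) (l m : ℕ) : Prop :=
  ∀ j, l < j → j < n → entry w l < entry w j → m ≤ entry w j

theorem rankCondition_iff (v w : Equiv.Perm (Fin n)) :
    RankCondition v w ↔ ∀ l < n, ∀ m ≤ n, rank w (l + 1) m ≤ rank v l m →
      NoLargerBefore v l m ∧ NoLargerAfter w l m := by
  constructor
  · intro h l hl m hm ht
    obtain ⟨h1, h2⟩ := h ⟨l, hl⟩ m hm ht
    refine ⟨fun j hj hlt => ?_, fun j hj hjn hlt => ?_⟩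
    · have := h1 ⟨j, by omega⟩ hj
      rw [Fin.lt_def, ← entry_val, ← entry_val] at this
      exact this hlt
    · have := h2 ⟨j, by omega⟩ hj
      rw [Fin.lt_def, ← entry_val, ← entry_val] at this
      exact this hlt
  · intro h l m hm ht
    obtain ⟨h1, h2⟩ := h l l.2 m hm ht
    refine ⟨fun j hj hlt => ?_, fun j hj hlt => ?_⟩
    · have := h1 j hj
      rw [entry_val, entry_val] at this
      exact this hlt
    · have := h2 j hj j.2
      rw [entry_val, entry_val] at this
      exact this hlt

variable (w : Equiv.Perm (Fin (n + 1)))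

/-- The position of the largest entry. -/
def lastPos : ℕ := w.symm (Fin.last n)

theorem lastPos_le : lastPos w ≤ n := Nat.lt_succ_iff.1 (w.symm (Fin.last n)).2

theorem entry_lastPos : entry w (lastPos w) = n := by
  rw [lastPos, entry_val]
  simp

theorem entry_induced (i : Fin n) :
    entry (induced w) i = entry w ((w.symm (Fin.last n)).succAbove i) := by
  rw [entry_val, entry_val, ← castSucc_induced]
  rfl

theorem val_succAbove (i : Fin n) : ((w.symm (Fin.last n)).succAbove i : ℕ) =
    if (i : ℕ) < lastPos w then (i : ℕ) else i + 1 := by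
  unfold lastPos
  split_ifs with h
  · rw [Fin.succAbove_of_castSucc_lt _ _ h]
    rfl
  · rw [Fin.succAbove_of_le_castSucc _ _ (not_lt.1 h)]
    rfl

theorem entry_induced_of_lt {i : ℕ} (hi : i < lastPos w) : entry (induced w) i = entry w i := by
  have := lastPos_le w
  have h := entry_induced w ⟨i, by omega⟩
  rwa [val_succAbove, if_pos hi] at h

theorem entry_induced_of_ge {i : ℕ} (hi : lastPos w ≤ i) (hin : i < n) :
    entry (induced w) i = entry w (i + 1) := by
  have h := entry_induced w ⟨i, hin⟩
  rwa [val_succAbove, if_neg hi.not_gt] at h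

theorem rank_eq_sum_induced (k : ℕ) {m : ℕ} (hm : m ≤ n) :
    rank w k m = ∑ i : Fin n, if ((w.symm (Fin.last n)).succAbove i : ℕ) < k ∧
      (induced w i : ℕ) < m then 1 else 0 := by
  rw [rank, Finset.card_filter, Fin.sum_univ_succAbove _ (w.symm (Fin.last n)), if_neg, zero_add]
  · refine Finset.sum_congr rfl fun i _ => ?_
    rw [← castSucc_induced]
    rfl
  · simp
    omega

theorem rank_induced_of_le {k m : ℕ} (hm : m ≤ n) (hk : k ≤ lastPos w) :
    rank (induced w) k m = rank w k m := by
  rw [rank_eq_sum_induced w k hm, rank, Finset.card_filter]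
  refine Finset.sum_congr rfl fun i _ => ?_
  rw [val_succAbove]
  congr 2
  split_ifs <;> simp <;> omega

theorem rank_induced_of_ge {k m : ℕ} (hm : m ≤ n) (hk : lastPos w ≤ k) :
    rank (induced w) k m = rank w (k + 1) m := by
  rw [rank_eq_sum_induced w _ hm, rank, Finset.card_filter]
  refine Finset.sum_congr rfl fun i _ => ?_
  rw [val_succAbove]
  congr 2
  split_ifs <;> simp <;> omega

theorem rank_last_of_le {k : ℕ} (hk : k ≤ lastPos w) : rank w k n = k := by
  have := lastPos_le w
  rw [← rank_induced_of_le w le_rfl hk, rank_of_le _ (by omega) le_rfl]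

theorem rank_last_of_ge {k : ℕ} (hk : lastPos w ≤ k) (hkn : k ≤ n) : rank w (k + 1) n = k := by
  rw [← rank_induced_of_ge w le_rfl hk, rank_of_le _ (by omega) le_rfl]

theorem noLargerBefore_induced_of_lt {l m : ℕ} (hl : l < lastPos w) :
    NoLargerBefore (induced w) l m ↔ NoLargerBefore w l m := by
  unfold NoLargerBefore
  refine forall₂_congr fun j hj => ?_
  rw [entry_induced_of_lt w hl, entry_induced_of_lt w (by omega)]

theorem noLargerBefore_induced_of_ge {l m : ℕ} (hm : m ≤ n) (hl : lastPos w ≤ l) (hln : l < n) :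
    NoLargerBefore (induced w) l m ↔ NoLargerBefore w (l + 1) m := by
  unfold NoLargerBefore
  rw [entry_induced_of_ge w hl hln]
  constructor
  · intro h j hj hlt
    rcases lt_trichotomy j (lastPos w) with h1 | h1 | h1
    · rw [← entry_induced_of_lt w h1] at hlt ⊢
      exact h j (by omega) hlt
    · rw [h1, entry_lastPos]
      exact hm
    · obtain ⟨i, rfl⟩ : ∃ i, j = i + 1 := ⟨j - 1, by omega⟩
      rw [← entry_induced_of_ge w (i := i) (by omega) (by omega)] at hlt ⊢
      exact h i (by omega) hlt
  · intro h j hj hlt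
    rcases lt_or_ge j (lastPos w) with h1 | h1
    · rw [entry_induced_of_lt w h1] at hlt ⊢
      exact h j (by omega) hlt
    · rw [entry_induced_of_ge w h1 (by omega)] at hlt ⊢
      exact h (j + 1) (by omega) hlt

theorem noLargerAfter_induced_of_lt {l m : ℕ} (hm : m ≤ n) (hl : l < lastPos w) :
    NoLargerAfter (induced w) l m ↔ NoLargerAfter w l m := by
  unfold NoLargerAfter
  rw [entry_induced_of_lt w hl]
  constructor
  · intro h j hj hjn hlt
    rcases lt_trichotomy j (lastPos w) with h1 | h1 | h1
    · rw [← entry_induced_of_lt w h1] at hlt ⊢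
      have := lastPos_le w
      exact h j (by omega) (by omega) hlt
    · rw [h1, entry_lastPos]
      exact hm
    · obtain ⟨i, rfl⟩ : ∃ i, j = i + 1 := ⟨j - 1, by omega⟩
      rw [← entry_induced_of_ge w (i := i) (by omega) (by omega)] at hlt ⊢
      exact h i (by omega) (by omega) hlt
  · intro h j hj hjn hlt
    rcases lt_or_ge j (lastPos w) with h1 | h1
    · rw [entry_induced_of_lt w h1] at hlt ⊢
      exact h j (by omega) (by omega) hlt
    · rw [entry_induced_of_ge w h1 (by omega)] at hlt ⊢
      exact h (j + 1) (by omega) (by omega) hlt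

theorem noLargerAfter_induced_of_ge {l m : ℕ} (hl : lastPos w ≤ l) (hln : l < n) :
    NoLargerAfter (induced w) l m ↔ NoLargerAfter w (l + 1) m := by
  unfold NoLargerAfter
  rw [entry_induced_of_ge w hl hln]
  constructor
  · intro h j hj hjn hlt
    obtain ⟨i, rfl⟩ : ∃ i, j = i + 1 := ⟨j - 1, by omega⟩
    rw [← entry_induced_of_ge w (i := i) (by omega) (by omega)] at hlt ⊢
    exact h i (by omega) (by omega) hlt
  · intro h j hj hjn hlt
    rw [entry_induced_of_ge w (by omega) (by omega)] at hlt ⊢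
    exact h (j + 1) (by omega) (by omega) hlt

theorem noLargerBefore_lastPos (m : ℕ) : NoLargerBefore w (lastPos w) m := by
  intro j hj hlt
  have := lastPos_le w
  have := entry_lt w (show j < n + 1 by omega)
  rw [entry_lastPos] at hlt
  omega

theorem noLargerAfter_lastPos (m : ℕ) : NoLargerAfter w (lastPos w) m := by
  intro j hj hjn hlt
  have := entry_lt w hjn
  rw [entry_lastPos] at hlt
  omega

theorem NoLargerBefore.mono {v : Equiv.Perm (Fin n)} {l m p : ℕ} (h : NoLargerBefore v l m)
    (hp : p ≤ m) : NoLargerBefore v l p := fun j hj hlt => hp.trans (h j hj hlt)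

theorem NoLargerAfter.mono {v : Equiv.Perm (Fin n)} {l m p : ℕ} (h : NoLargerAfter v l m)
    (hp : p ≤ m) : NoLargerAfter v l p := fun j hj hjn hlt => hp.trans (h j hj hjn hlt)

end entry

/-! ### Recursive description of the rank condition -/

section recursion

variable {n : ℕ} {v w : Equiv.Perm (Fin (n + 1))}

/-- The rank condition for `(v, w)` in terms of the induced pair: outside the positions between the
positions `t'` and `t` of the largest entries the conditions agree, and between them the
rank inequality for `(v, w)` compares the two induced permutations at the same position. -/
theorem rankCondition_iff_induced (ht : lastPos w ≤ lastPos v) :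
    RankCondition v w ↔
      (∀ l < n, l < lastPos w ∨ lastPos v ≤ l → ∀ m ≤ n,
        rank (induced w) (l + 1) m ≤ rank (induced v) l m →
          NoLargerBefore (induced v) l m ∧ NoLargerAfter (induced w) l m) ∧
      ∀ m ≤ n, (∀ l, lastPos w ≤ l → l < lastPos v →
        rank (induced w) l m ≤ rank (induced v) l m → NoLargerBefore (induced v) l m) ∧
        ∀ l, lastPos w ≤ l → l < lastPos v →
          rank (induced w) (l + 1) m ≤ rank (induced v) (l + 1) m →
            NoLargerAfter (induced w) l m := by
  have hv := lastPos_le v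
  rw [rankCondition_iff]
  constructor
  · intro h
    refine ⟨fun l hl hlt m hm hr => ?_, fun m hm => ⟨fun l h1 h2 hr => ?_, fun l h1 h2 hr => ?_⟩⟩
    · rcases hlt with hlt | hlt
      · rw [rank_induced_of_le w hm (by omega), rank_induced_of_le v hm (by omega)] at hr
        rw [noLargerBefore_induced_of_lt v (by omega), noLargerAfter_induced_of_lt w hm hlt]
        exact h l (by omega) m (by omega) hr
      · rw [rank_induced_of_ge w hm (by omega), rank_induced_of_ge v hm (by omega)] at hr
        rw [noLargerBefore_induced_of_ge v hm hlt hl,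
          noLargerAfter_induced_of_ge w (by omega) hl]
        exact h (l + 1) (by omega) m (by omega) hr
    · rw [rank_induced_of_ge w hm h1, rank_induced_of_le v hm h2.le] at hr
      rw [noLargerBefore_induced_of_lt v h2]
      exact (h l (by omega) m (by omega) hr).1
    · rw [rank_induced_of_ge w hm (by omega), rank_induced_of_le v hm h2] at hr
      rw [noLargerAfter_induced_of_ge w h1 (by omega)]
      exact (h (l + 1) (by omega) m (by omega) hr).2
  · rintro ⟨h1, h2⟩ l hl m hm hr
    rcases Nat.eq_or_lt_of_le hm with rfl | hm
    · rw [rank_of_le w (by omega) le_rfl, rank_of_le v (by omega) le_rfl] at hr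
      omega
    have hm : m ≤ n := by omega
    rcases lt_or_ge l (lastPos w) with hlt | hge
    · rw [← rank_induced_of_le w hm (by omega), ← rank_induced_of_le v hm (by omega)] at hr
      rw [← noLargerBefore_induced_of_lt v (by omega), ← noLargerAfter_induced_of_lt w hm hlt]
      exact h1 l (by omega) (Or.inl hlt) m hm hr
    rcases lt_or_ge (lastPos v) l with hlt | hle
    · obtain ⟨k, rfl⟩ : ∃ k, l = k + 1 := ⟨l - 1, by omega⟩
      rw [← rank_induced_of_ge w hm (by omega), ← rank_induced_of_ge v hm (by omega)] at hr
      rw [← noLargerBefore_induced_of_ge v hm (by omega) (by omega),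
        ← noLargerAfter_induced_of_ge w (by omega) (by omega)]
      exact h1 k (by omega) (Or.inr (by omega)) m hm hr
    rw [← rank_induced_of_ge w hm hge, ← rank_induced_of_le v hm hle] at hr
    constructor
    · rcases Nat.eq_or_lt_of_le hle with rfl | hlt
      · exact noLargerBefore_lastPos v m
      · rw [← noLargerBefore_induced_of_lt v hlt]
        exact (h2 m hm).1 l hge hlt hr
    · rcases Nat.eq_or_lt_of_le hge with rfl | hlt
      · exact noLargerAfter_lastPos w m
      · obtain ⟨k, rfl⟩ : ∃ k, l = k + 1 := ⟨l - 1, by omega⟩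
        rw [← noLargerAfter_induced_of_ge w (by omega) (by omega)]
        exact (h2 m hm).2 k (by omega) (by omega) hr

theorem lastPos_le_of_rank_le (h : ∀ k m, rank w k m ≤ rank v k m) : lastPos w ≤ lastPos v := by
  by_contra hlt
  have h1 := h (lastPos v + 1) n
  rw [rank_last_of_ge v le_rfl (lastPos_le v), rank_last_of_le w (by omega)] at h1
  omega

/-- The Bruhat order for `(v, w)` in terms of the ranks of the induced pair. -/
theorem rank_le_iff_induced (ht : lastPos w ≤ lastPos v) :
    (∀ k m, rank w k m ≤ rank v k m) ↔
      (∀ k m, m ≤ n → k ≤ lastPos w ∨ lastPos v ≤ k →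
        rank (induced w) k m ≤ rank (induced v) k m) ∧
      ∀ k m, m ≤ n → lastPos w ≤ k → k < lastPos v →
        rank (induced w) k m ≤ rank (induced v) (k + 1) m := by
  constructor
  · intro h
    refine ⟨fun k m hm hk => ?_, fun k m hm h1 h2 => ?_⟩
    · rcases hk with hk | hk
      · rw [rank_induced_of_le w hm hk, rank_induced_of_le v hm (by omega)]
        exact h k m
      · rw [rank_induced_of_ge w hm (by omega), rank_induced_of_ge v hm hk]
        exact h (k + 1) m
    · rw [rank_induced_of_ge w hm h1, rank_induced_of_le v hm h2]
      exact h (k + 1) m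
  · rintro ⟨h1, h2⟩ k m
    rcases lt_or_ge n m with hm | hm
    · rcases le_total k (n + 1) with hk | hk
      · rw [rank_of_le _ hk hm, rank_of_le _ hk hm]
      · rw [rank_left_of_le _ hk, rank_left_of_le _ hk, rank_of_le _ le_rfl hm,
          rank_of_le _ le_rfl hm]
    rcases le_or_gt k (lastPos w) with hk | hk
    · rw [← rank_induced_of_le w hm hk, ← rank_induced_of_le v hm (by omega)]
      exact h1 k m hm (Or.inl hk)
    obtain ⟨k, rfl⟩ : ∃ i, k = i + 1 := ⟨k - 1, by omega⟩
    rw [← rank_induced_of_ge w hm (by omega)]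
    rcases lt_or_ge k (lastPos v) with hkv | hkv
    · rw [← rank_induced_of_le v hm hkv]
      exact h2 k m hm (by omega) hkv
    · rw [← rank_induced_of_ge v hm hkv]
      exact h1 k m hm (Or.inr hkv)

end recursion

section compatible

variable {n : ℕ}

/-- The positions between `p` and `q` carry entries of `a` that exceed all earlier entries and
entries of `b` that exceed all later entries. -/
def Extremal (a b : Equiv.Perm (Fin n)) (p q : ℕ) : Prop :=
  ∀ l, p ≤ l → l < q → NoLargerBefore a l n ∧ NoLargerAfter b l n

theorem Extremal.lt_left {a b : Equiv.Perm (Fin n)} {p q l j : ℕ} (h : Extremal a b p q)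
    (hp : p ≤ l) (hq : l < q) (hqn : q ≤ n) (hj : j < l) : entry a j < entry a l := by
  have h1 := (h l hp hq).1 j hj
  have h2 := entry_lt a (show j < n by omega)
  have h3 : entry a j ≠ entry a l := fun he =>
    hj.ne (entry_inj a (by omega) (by omega) he)
  omega

theorem Extremal.lt_right {a b : Equiv.Perm (Fin n)} {p q l j : ℕ} (h : Extremal a b p q)
    (hp : p ≤ l) (hq : l < q) (hj : l < j) (hjn : j < n) : entry b j < entry b l := by
  have h1 := (h l hp hq).2 j hj hjn
  have h2 := entry_lt b hjn
  have h3 : entry b j ≠ entry b l := fun he =>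
    hj.ne' (entry_inj b (by omega) (by omega) he)
  omega

theorem extremal_of_rankCondition {a b : Equiv.Perm (Fin (n + 1))} {p q : ℕ} (hqn : q ≤ n + 1)
    (h : RankCondition a b) (hb : lastPos b < q)
    (ha : p ≤ lastPos a)
    (hdec : ∀ i j, p ≤ i → i < j → j < q → entry b j < entry b i)
    (hinc : ∀ i j, p ≤ i → i < j → j < q → entry a i < entry a j) : Extremal a b p q := by
  have hbn := entry_lastPos b
  have han := entry_lastPos a
  have hal := lastPos_le a
  have hb' : lastPos b ≤ p := by
    by_contra hlt
    have := hdec p (lastPos b) le_rfl (by omega) hb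
    have := entry_lt b (show p < n + 1 by omega)
    omega
  have ha' : q ≤ lastPos a + 1 := by
    by_contra hlt
    have := hinc (lastPos a) (q - 1) ha (by omega) (by omega)
    have := entry_lt a (show q - 1 < n + 1 by omega)
    omega
  intro l hp hq
  obtain ⟨h1, h2⟩ := (rankCondition_iff a b).1 h l (by omega) n (by omega) (by
    rw [rank_last_of_ge b (by omega) (by omega), rank_last_of_le a (by omega)])
  constructor
  · intro j hj hlt
    have h3 := h1 j hj hlt
    have h4 : entry a j ≠ entry a (lastPos a) := fun he => by
      have := entry_inj a (by omega) (by omega) he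
      omega
    omega
  · intro j hj hjn hlt
    have h3 := h2 j hj hjn hlt
    have h4 : entry b j ≠ entry b (lastPos b) := fun he => by
      have := entry_inj b (by omega) (by omega) he
      omega
    omega

/-- Between the positions `p` and `q`, the rank inequality for `(a, b)` follows from the
inequalities outside. -/
theorem Extremal.rank_le {a b : Equiv.Perm (Fin n)} {p q : ℕ} (h : Extremal a b p q)
    (hqn : q ≤ n) (hout : ∀ k m, m ≤ n → k ≤ p ∨ q ≤ k → rank b k m ≤ rank a k m) (k m : ℕ)
    (hm : m ≤ n) : rank b k m ≤ rank a k m := by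
  induction k with
  | zero => simp [rank_zero_left]
  | succ l ih =>
    by_cases hl : l + 1 ≤ p ∨ q ≤ l + 1
    · exact hout _ m hm hl
    have ha := rank_succ_left a ⟨l, by omega⟩ m
    have hb := rank_succ_left b ⟨l, by omega⟩ m
    simp only [← entry_val] at ha hb
    rcases lt_or_ge (entry a l) m with h1 | h1
    · rw [ha, if_pos h1, hb]
      split_ifs <;> omega
    rcases lt_or_ge (entry b l) m with h2 | h2
    · -- all later entries of `b` are below `m`, and no entry of `a` in positions `l, …, q - 1` is
      have h3 : ∀ d, l + 1 + d ≤ q →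
          rank b (l + 1) m + d ≤ rank b (l + 1 + d) m ∧
            rank a (l + 1 + d) m ≤ rank a (l + 1) m := by
        intro d
        induction d with
        | zero => intro _; exact ⟨le_rfl, le_rfl⟩
        | succ d ihd =>
          intro hd
          obtain ⟨h4, h5⟩ := ihd (by omega)
          have h6 := rank_succ_left a ⟨l + 1 + d, by omega⟩ m
          have h7 := rank_succ_left b ⟨l + 1 + d, by omega⟩ m
          simp only [← entry_val] at h6 h7
          have h8 := h.lt_left (j := l) (l := l + 1 + d) (by omega) (by omega) hqn (by omega)
          have h9 := h.lt_right (l := l) (j := l + 1 + d) (by omega) (by omega) (by omega)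
            (by omega)
          rw [if_neg (by omega)] at h6
          rw [if_pos (by omega)] at h7
          rw [← add_assoc, ← add_assoc]
          omega
      obtain ⟨h4, h5⟩ := h3 (q - (l + 1)) (by omega)
      rw [show l + 1 + (q - (l + 1)) = q by omega] at h4 h5
      have := hout q m hm (Or.inr le_rfl)
      omega
    · rw [hb, if_neg (by omega), ha]
      omega

theorem compatible_iff_entry (v w : Equiv.Perm (Fin (n + 2))) :
    Compatible v w ↔ lastPos v = lastPos w ∨
      (lastPos w < lastPos v ∧ (w.symm (Fin.last n).castSucc : ℕ) ≤ lastPos v ∧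
        lastPos w ≤ (v.symm (Fin.last n).castSucc : ℕ) ∧
        (∀ i j, lastPos w ≤ i → i < j → j ≤ lastPos v → entry w j < entry w i) ∧
        ∀ i j, lastPos w ≤ i → i < j → j ≤ lastPos v → entry v i < entry v j) := by
  have hv := lastPos_le v
  unfold Compatible
  simp only
  refine or_congr Fin.ext_iff (and_congr Fin.lt_def (and_congr Fin.le_def
    (and_congr Fin.le_def (and_congr ?_ ?_))))
  · constructor
    · intro h i j hi hij hj
      have := h (a := ⟨i, by omega⟩) (b := ⟨j, by omega⟩) ⟨hi, hij.le.trans hj⟩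
        ⟨hi.trans hij.le, hj⟩ hij
      rwa [Fin.lt_def, ← entry_val, ← entry_val] at this
    · intro h i hi j hj hij
      rw [Fin.lt_def, ← entry_val, ← entry_val]
      exact h i j hi.1 hij hj.2
  · constructor
    · intro h i j hi hij hj
      have := h (a := ⟨i, by omega⟩) (b := ⟨j, by omega⟩) ⟨hi, hij.le.trans hj⟩
        ⟨hi.trans hij.le, hj⟩ hij
      rwa [Fin.lt_def, ← entry_val, ← entry_val] at this
    · intro h i hi j hj hij
      rw [Fin.lt_def, ← entry_val, ← entry_val]
      exact h i j hi.1 hij hj.2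

/-- The position of the second largest entry, in terms of the induced permutation. -/
theorem symm_castSucc_last (w : Equiv.Perm (Fin (n + 2))) :
    (w.symm (Fin.last n).castSucc : ℕ) =
      if lastPos (induced w) < lastPos w then lastPos (induced w)
      else lastPos (induced w) + 1 := by
  have h1 : entry w (w.symm (Fin.last n).castSucc) = n := by
    rw [entry_val]
    simp
  have h2 := entry_lastPos (induced w)
  have h3 := lastPos_le (induced w)
  refine entry_inj w (w.symm _).2 ?_ ?_
  · split_ifs <;> omega
  · rw [h1]
    split_ifs with h
    · rw [← entry_induced_of_lt w h, h2]
    · rw [← entry_induced_of_ge w (by omega) (by omega), h2]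

/-- Compatibility of `(v, w)` in terms of the induced pair. -/
theorem compatible_iff_induced (v w : Equiv.Perm (Fin (n + 2))) :
    Compatible v w ↔ lastPos v = lastPos w ∨
      (lastPos w < lastPos v ∧ lastPos (induced w) < lastPos v ∧
        lastPos w ≤ lastPos (induced v) ∧
        (∀ i j, lastPos w ≤ i → i < j → j < lastPos v →
          entry (induced w) j < entry (induced w) i) ∧
        ∀ i j, lastPos w ≤ i → i < j → j < lastPos v →
          entry (induced v) i < entry (induced v) j) := by
  have hv := lastPos_le v
  have hvn := entry_lastPos v
  have hwn := entry_lastPos w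
  rw [compatible_iff_entry]
  refine or_congr_right (and_congr_right fun hlt => and_congr ?_ (and_congr ?_
    (and_congr ?_ ?_)))
  · rw [symm_castSucc_last]
    split_ifs <;> omega
  · rw [symm_castSucc_last]
    split_ifs <;> omega
  · constructor
    · intro h i j hi hij hj
      rw [entry_induced_of_ge w (by omega) (by omega),
        entry_induced_of_ge w (by omega) (by omega)]
      exact h _ _ (by omega) (by omega) (by omega)
    · intro h i j hi hij hj
      obtain ⟨j, rfl⟩ : ∃ k, j = k + 1 := ⟨j - 1, by omega⟩
      rcases Nat.eq_or_lt_of_le hi with rfl | hi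
      · have h1 := entry_lt w (show j + 1 < n + 2 by omega)
        have h2 : entry w (j + 1) ≠ entry w (lastPos w) := fun he =>
          hij.ne' (entry_inj w (by omega) (by omega) he)
        omega
      · obtain ⟨i, rfl⟩ : ∃ k, i = k + 1 := ⟨i - 1, by omega⟩
        rw [← entry_induced_of_ge w (i := i) (by omega) (by omega),
          ← entry_induced_of_ge w (i := j) (by omega) (by omega)]
        exact h _ _ (by omega) (by omega) (by omega)
  · constructor
    · intro h i j hi hij hj
      rw [entry_induced_of_lt v (by omega), entry_induced_of_lt v (by omega)]
      exact h _ _ (by omega) (by omega) (by omega)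
    · intro h i j hi hij hj
      rcases Nat.eq_or_lt_of_le hj with rfl | hj
      · have h1 := entry_lt v (show i < n + 2 by omega)
        have h2 : entry v i ≠ entry v (lastPos v) := fun he =>
          hij.ne (entry_inj v (by omega) (by omega) he)
        omega
      · rw [← entry_induced_of_lt v (i := i) (by omega),
          ← entry_induced_of_lt v (i := j) (by omega)]
        exact h _ _ (by omega) (by omega) (by omega)

/-- The Bruhat order together with the rank condition obeys the recursion that defines `𝒯ₙ`. -/
theorem rankCondition_and_rank_le_iff (v w : Equiv.Perm (Fin (n + 2))) :
    (RankCondition v w ∧ ∀ k m, rank w k m ≤ rank v k m) ↔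
      (RankCondition (induced v) (induced w) ∧
        ∀ k m, rank (induced w) k m ≤ rank (induced v) k m) ∧ Compatible v w := by
  have hv := lastPos_le v
  -- arguments `m` above the size of a permutation carry no information
  have hext : ∀ a b : Equiv.Perm (Fin (n + 1)),
      (∀ k m, m ≤ n + 1 → rank b k m ≤ rank a k m) → ∀ k m, rank b k m ≤ rank a k m := by
    intro a b h k m
    rcases le_total m (n + 1) with hm | hm
    · exact h k m hm
    · rw [← height_firstValues, ← height_firstValues, height_of_le _ hm, height_of_le _ hm,
        ← height_of_le _ le_rfl, ← height_of_le (firstValues a k) le_rfl, height_firstValues,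
        height_firstValues]
      exact h k _ le_rfl
  rw [compatible_iff_induced]
  constructor
  · rintro ⟨hR, hle⟩
    have ht := lastPos_le_of_rank_le hle
    rw [rankCondition_iff_induced ht] at hR
    rw [rank_le_iff_induced ht] at hle
    rw [rankCondition_iff]
    rcases Nat.eq_or_lt_of_le ht with heq | hlt
    · exact ⟨⟨fun l hl m hm => hR.1 l hl (by omega) m hm,
        hext _ _ fun k m hm => hle.1 k m hm (by omega)⟩, Or.inl heq.symm⟩
    -- at `m = n + 1` the rank inequality holds with equality
    have hE : Extremal (induced v) (induced w) (lastPos w) (lastPos v) := fun l h1 h2 =>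
      ⟨(hR.2 (n + 1) le_rfl).1 l h1 h2 (by
          rw [rank_of_le _ (by omega) le_rfl, rank_of_le _ (by omega) le_rfl]),
        (hR.2 (n + 1) le_rfl).2 l h1 h2 (by
          rw [rank_of_le _ (by omega) le_rfl, rank_of_le _ (by omega) le_rfl])⟩
    have hvn := entry_lastPos (induced v)
    have hwn := entry_lastPos (induced w)
    have hv' := lastPos_le (induced v)
    have hw' := lastPos_le (induced w)
    refine ⟨⟨fun l hl m hm hr => ?_, hext _ _ (hE.rank_le hv hle.1)⟩, Or.inr ⟨hlt, ?_, ?_,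
      fun i j hi hij hj => hE.lt_right hi (by omega) hij (by omega),
      fun i j hi hij hj => hE.lt_left (by omega) hj hv hij⟩⟩
    · by_cases hl' : l < lastPos w ∨ lastPos v ≤ l
      · exact hR.1 l hl hl' m hm hr
      · obtain ⟨h1, h2⟩ := hE l (by omega) (by omega)
        exact ⟨h1.mono hm, h2.mono hm⟩
    · by_contra hcon
      have h1 := hE.lt_right (l := lastPos v - 1) (j := lastPos (induced w)) (by omega) (by omega)
        (by omega) (by omega)
      have := entry_lt (induced w) (show lastPos v - 1 < n + 1 by omega)
      omega
    · by_contra hcon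
      have h1 := hE.lt_left (l := lastPos w) (j := lastPos (induced v)) (by omega) (by omega)
        hv (by omega)
      have := entry_lt (induced v) (show lastPos w < n + 1 by omega)
      omega
  · rintro ⟨⟨hR, hle⟩, hc⟩
    have ht : lastPos w ≤ lastPos v := by omega
    rw [rankCondition_iff_induced ht, rank_le_iff_induced ht]
    have hR' := (rankCondition_iff _ _).1 hR
    refine ⟨⟨fun l hl _ m hm => hR' l hl m hm, fun m hm => ?_⟩, fun k m _ _ => hle k m,
      fun k m _ _ _ => (hle k m).trans (rank_mono_left _ (Nat.le_succ k) m)⟩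
    rcases hc with heq | ⟨hlt, h1, h2, h3, h4⟩
    · exact ⟨fun l _ _ => by omega, fun l _ _ => by omega⟩
    · have hE := extremal_of_rankCondition hv hR h1 h2 h3 h4
      exact ⟨fun l hl1 hl2 _ => (hE l hl1 hl2).1.mono hm,
        fun l hl1 hl2 _ => (hE l hl1 hl2).2.mono hm⟩

end compatible

/-- The set `𝒯ₙ` consists of the pairs in Bruhat order that satisfy the rank condition. -/
theorem inT_iff : ∀ {n : ℕ} (_ : 1 ≤ n) (v w : Equiv.Perm (Fin n)),
    InT v w ↔ RankCondition v w ∧ ∀ k m, rank w k m ≤ rank v k m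
  | 1, _, v, w => by
    have hv : v = 1 := Subsingleton.elim _ _
    have hw : w = 1 := Subsingleton.elim _ _
    subst hv hw
    refine iff_of_true ⟨rfl, rfl⟩ ⟨fun l m _ _ => ⟨fun j hj => ?_, fun j hj => ?_⟩,
      fun _ _ => le_rfl⟩ <;> exact absurd (Subsingleton.elim j l) (by omega)
  | n + 2, _, v, w => by
    rw [rankCondition_and_rank_le_iff, ← inT_iff (by omega)]
    rfl

/-- For pairs in Bruhat order, membership in `𝒯ₙ` means that the Richardson set is
swap-closed. -/
theorem inT_iff_swapClosed {n : ℕ} (hn : 1 ≤ n) {v w : Equiv.Perm (Fin n)} (h : BruhatLE v w) :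
    InT v w ↔ SwapClosed (richardsonSet v w) := by
  rw [bruhatLE_iff_rank] at h
  rw [inT_iff hn]
  exact ⟨fun hR => hR.1.swapClosed, fun hS => ⟨rankCondition_of_swapClosed h hS, h⟩⟩

/-! ### Initial forms and monomial maps -/

section weights

variable {K σ τ : Type*} [Field K]

/-- The polynomials all of whose terms have weight at least `c`. -/
noncomputable def weightGE (ω : σ → ℕ) (c : ℕ) : Submodule K (MvPolynomial σ K) :=
  restrictSupport K {d | c ≤ Finsupp.weight ω d}

theorem mem_weightGE {ω : σ → ℕ} {c : ℕ} {p : MvPolynomial σ K} :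
    p ∈ weightGE ω c ↔ ∀ d ∈ p.support, c ≤ Finsupp.weight ω d := by
  rw [weightGE, mem_restrictSupport_iff]
  rfl

theorem weightGE_anti (ω : σ → ℕ) {b c : ℕ} (h : b ≤ c) :
    (weightGE ω c : Submodule K (MvPolynomial σ K)) ≤ weightGE ω b :=
  fun _ hp => mem_weightGE.2 fun d hd => h.trans (mem_weightGE.1 hp d hd)

theorem mul_mem_weightGE {ω : σ → ℕ} {b c : ℕ} {p q : MvPolynomial σ K} (hp : p ∈ weightGE ω b)
    (hq : q ∈ weightGE ω c) : p * q ∈ weightGE ω (b + c) := by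
  classical
  rw [mem_weightGE] at *
  intro d hd
  obtain ⟨x, hx, y, hy, rfl⟩ := Finset.mem_add.1 (support_mul p q hd)
  rw [map_add]
  exact add_le_add (hp x hx) (hq y hy)

theorem monomial_mem_weightGE {ω : σ → ℕ} {c : ℕ} {d : σ →₀ ℕ} (h : c ≤ Finsupp.weight ω d)
    (a : K) : monomial d a ∈ weightGE ω c :=
  (monomial_mem_restrictSupport K).2 (Or.inl h)

theorem eq_zero_of_mem_weightGE {ω : σ → ℕ} {c : ℕ} {p : MvPolynomial σ K}
    (hp : IsWeightedHomogeneous ω p c) (h : p ∈ weightGE ω (c + 1)) : p = 0 := by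
  rw [← support_eq_empty, Finset.eq_empty_iff_forall_notMem]
  intro d hd
  have h1 := mem_weightGE.1 h d hd
  have h2 := hp (mem_support_iff.1 hd)
  omega

theorem coeff_initialForm (ω : σ → ℕ) (p : MvPolynomial σ K) (d : σ →₀ ℕ) :
    coeff d (initialForm ω p) =
      if Finsupp.weight ω d = lowestWeight ω p then coeff d p else 0 :=
  coeff_weightedHomogeneousComponent _ _ _

theorem isWeightedHomogeneous_initialForm (ω : σ → ℕ) (p : MvPolynomial σ K) :
    IsWeightedHomogeneous ω (initialForm ω p) (lowestWeight ω p) :=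
  weightedHomogeneousComponent_isWeightedHomogeneous _ _

theorem lowestWeight_le {ω : σ → ℕ} {p : MvPolynomial σ K} {d : σ →₀ ℕ} (hd : d ∈ p.support) :
    lowestWeight ω p ≤ Finsupp.weight ω d :=
  Nat.sInf_le ⟨d, hd, rfl⟩

theorem exists_weight_eq_lowestWeight (ω : σ → ℕ) {p : MvPolynomial σ K} (hp : p ≠ 0) :
    ∃ d ∈ p.support, Finsupp.weight ω d = lowestWeight ω p := by
  obtain ⟨d, hd⟩ := support_nonempty.2 hp
  exact Nat.sInf_mem (s := {m | ∃ d ∈ p.support, Finsupp.weight ω d = m}) ⟨_, d, hd, rfl⟩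

theorem sub_initialForm_mem (ω : σ → ℕ) (p : MvPolynomial σ K) :
    p - initialForm ω p ∈ weightGE ω (lowestWeight ω p + 1) := by
  rw [mem_weightGE]
  intro d hd
  rw [mem_support_iff, coeff_sub, coeff_initialForm] at hd
  split_ifs at hd with h
  · simp at hd
  · have := lowestWeight_le (ω := ω) (p := p) (mem_support_iff.2 (by simpa using hd))
    omega

theorem initialForm_ne_zero (ω : σ → ℕ) {p : MvPolynomial σ K} (hp : p ≠ 0) :
    initialForm ω p ≠ 0 := by
  obtain ⟨d, hd, hw⟩ := exists_weight_eq_lowestWeight ω hp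
  rw [ne_zero_iff]
  exact ⟨d, by rw [coeff_initialForm, if_pos hw]; exact mem_support_iff.1 hd⟩

theorem lowestWeight_eq {ω : σ → ℕ} {c : ℕ} {p q : MvPolynomial σ K} (hq0 : q ≠ 0)
    (hq : IsWeightedHomogeneous ω q c) (h : p - q ∈ weightGE ω (c + 1)) :
    lowestWeight ω p = c := by
  have key : ∀ d, Finsupp.weight ω d < c + 1 → coeff d p = coeff d q := by
    intro d hd
    by_contra hne
    have := mem_weightGE.1 h d (by rwa [mem_support_iff, coeff_sub, sub_ne_zero])
    omega
  obtain ⟨d, hd⟩ := ne_zero_iff.1 hq0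
  have hdw := hq hd
  have h1 : lowestWeight ω p ≤ c := by
    rw [← hdw]
    exact lowestWeight_le (by rwa [mem_support_iff, key d (by omega)])
  have hp : p ≠ 0 := ne_zero_iff.2 ⟨d, by rwa [key d (by omega)]⟩
  obtain ⟨d', hd', hw'⟩ := exists_weight_eq_lowestWeight ω hp
  rw [mem_support_iff, key d' (by omega)] at hd'
  rw [← hw', hq hd']

theorem initialForm_eq {ω : σ → ℕ} {c : ℕ} {p q : MvPolynomial σ K} (hq0 : q ≠ 0)
    (hq : IsWeightedHomogeneous ω q c) (h : p - q ∈ weightGE ω (c + 1)) :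
    initialForm ω p = q := by
  ext d
  rw [coeff_initialForm, lowestWeight_eq hq0 hq h]
  split_ifs with hd
  · by_contra hne
    have := mem_weightGE.1 h d (by rwa [mem_support_iff, coeff_sub, sub_ne_zero])
    omega
  · by_contra hne
    exact hd (hq (Ne.symm hne))

/-- The algebra map that sends each variable to a monomial. -/
noncomputable def monomialMap (K : Type*) [Field K] (e : τ → σ →₀ ℕ) :
    MvPolynomial τ K →ₐ[K] MvPolynomial σ K :=
  aeval fun J => monomial (e J) 1

theorem monomialMap_monomial (e : τ → σ →₀ ℕ) (M : τ →₀ ℕ) (a : K) :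
    monomialMap K e (monomial M a) = monomial (Finsupp.linearCombination ℕ e M) a := by
  rw [monomialMap, aeval_monomial, algebraMap_eq, Finsupp.linearCombination_apply]
  simp only [monomial_pow, one_pow]
  rw [Finsupp.prod, Finsupp.sum, ← monomial_sum_one, C_mul_monomial, mul_one]

/-- The kernel of a monomial map is generated by binomials. -/
theorem ker_monomialMap (e : τ → σ →₀ ℕ) :
    RingHom.ker (monomialMap K e) = Ideal.span ((fun p : (τ →₀ ℕ) × (τ →₀ ℕ) =>
      monomial p.1 (1 : K) - monomial p.2 1) ''
        {p | Finsupp.linearCombination ℕ e p.1 = Finsupp.linearCombination ℕ e p.2}) := by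
  set E := Finsupp.linearCombination ℕ e
  set I := Ideal.span ((fun p : (τ →₀ ℕ) × (τ →₀ ℕ) =>
      monomial p.1 (1 : K) - monomial p.2 1) '' {p | E p.1 = E p.2}) with hI
  apply le_antisymm
  · intro f hf
    -- a linear map that sends `X ^ d` to the class of any monomial mapped to `X ^ d`
    let ψ : MvPolynomial σ K →ₗ[K] MvPolynomial τ K ⧸ I :=
      (basisMonomials σ K).constr K fun d =>
        Ideal.Quotient.mk I (monomial (Function.invFun E d) 1)
    have hψ : ψ ∘ₗ (monomialMap K e).toLinearMap = (Ideal.Quotient.mkₐ K I).toLinearMap := by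
      refine (basisMonomials τ K).ext fun M => ?_
      simp only [coe_basisMonomials, LinearMap.comp_apply, AlgHom.toLinearMap_apply,
        monomialMap_monomial]
      have h1 := (basisMonomials σ K).constr_basis K
        (fun d => Ideal.Quotient.mk I (monomial (Function.invFun E d) 1)) (E M)
      rw [coe_basisMonomials] at h1
      refine h1.trans ?_
      rw [Ideal.Quotient.mkₐ_eq_mk, Ideal.Quotient.eq]
      exact Ideal.subset_span ⟨(_, M), Function.invFun_eq ⟨M, rfl⟩, rfl⟩
    have h0 := LinearMap.congr_fun hψ f
    rw [RingHom.mem_ker] at hf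
    rw [LinearMap.comp_apply, AlgHom.toLinearMap_apply, hf, map_zero] at h0
    exact Ideal.Quotient.eq_zero_iff_mem.1 h0.symm
  · rw [Ideal.span_le]
    rintro _ ⟨⟨M, N⟩, h, rfl⟩
    rw [SetLike.mem_coe, RingHom.mem_ker, map_sub, monomialMap_monomial, monomialMap_monomial]
    exact sub_eq_zero.2 (congrArg (fun d => monomial d (1 : K)) h)

section leading

variable {ω : σ → ℕ} {f : τ → MvPolynomial σ K} {e : τ → σ →₀ ℕ}

theorem weight_linearCombination (ω : σ → ℕ) (e : τ → σ →₀ ℕ) (M : τ →₀ ℕ) :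
    Finsupp.weight ω (Finsupp.linearCombination ℕ e M) =
      Finsupp.weight (fun J => Finsupp.weight ω (e J)) M := by
  rw [Finsupp.linearCombination_apply, Finsupp.sum, map_sum,
    Finsupp.weight_apply (fun J => Finsupp.weight ω (e J)), Finsupp.sum]
  refine Finset.sum_congr rfl fun J _ => ?_
  rw [map_nsmul]

/-- If `X ^ e J` is the part of lowest weight of `f J`, then the image of a monomial under the
substitution by `f` has the image under the monomial map as its part of lowest weight. -/
theorem aeval_monomial_sub_mem
    (hf : ∀ J, f J - monomial (e J) 1 ∈ weightGE ω (Finsupp.weight ω (e J) + 1)) (M : τ →₀ ℕ) :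
    aeval f (monomial M (1 : K)) - monomial (Finsupp.linearCombination ℕ e M) 1 ∈
      weightGE ω (Finsupp.weight ω (Finsupp.linearCombination ℕ e M) + 1) := by
  set E := Finsupp.linearCombination ℕ e with hE
  have hadd : ∀ M N : τ →₀ ℕ,
      aeval f (monomial M (1 : K)) - monomial (E M) 1 ∈
        weightGE ω (Finsupp.weight ω (E M) + 1) →
      aeval f (monomial N (1 : K)) - monomial (E N) 1 ∈
        weightGE ω (Finsupp.weight ω (E N) + 1) →
      aeval f (monomial (M + N) (1 : K)) - monomial (E (M + N)) 1 ∈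
        weightGE ω (Finsupp.weight ω (E (M + N)) + 1) := by
    intro M N hM hN
    have h1 : monomial (M + N) (1 : K) = monomial M 1 * monomial N 1 := by
      rw [monomial_mul, one_mul]
    have h2 : (monomial (E (M + N)) (1 : K)) = monomial (E M) 1 * monomial (E N) 1 := by
      rw [monomial_mul, one_mul, map_add]
    have h3 : aeval f (monomial M (1 : K)) * aeval f (monomial N (1 : K)) -
        monomial (E M) 1 * monomial (E N) 1 =
        (aeval f (monomial M (1 : K)) - monomial (E M) 1) *
          ((aeval f (monomial N (1 : K)) - monomial (E N) 1) + monomial (E N) 1) +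
        monomial (E M) 1 * (aeval f (monomial N (1 : K)) - monomial (E N) 1) := by
      ring
    rw [h1, h2, map_mul, h3, map_add, map_add]
    have hN' := weightGE_anti ω (Nat.le_succ _) hN
    refine Submodule.add_mem _ ?_ ?_
    · refine weightGE_anti ω ?_ (mul_mem_weightGE hM
        (Submodule.add_mem _ hN' (monomial_mem_weightGE le_rfl 1)))
      omega
    · refine weightGE_anti ω ?_ (mul_mem_weightGE (monomial_mem_weightGE le_rfl 1) hN)
      omega
  induction M using Finsupp.induction_linear with
  | zero => simp
  | add M N hM hN => exact hadd M N hM hN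
  | single J c =>
    induction c with
    | zero => simp
    | succ c ih =>
      rw [Finsupp.single_add]
      refine hadd _ _ ih ?_
      have h1 : E (Finsupp.single J 1) = e J := by simp [hE]
      rw [h1]
      change aeval f (X J) - _ ∈ _
      rw [aeval_X]
      exact hf J

theorem aeval_sub_monomialMap_mem
    (hf : ∀ J, f J - monomial (e J) 1 ∈ weightGE ω (Finsupp.weight ω (e J) + 1))
    {p : MvPolynomial τ K} {c : ℕ}
    (hp : p ∈ weightGE (fun J => Finsupp.weight ω (e J)) c) :
    aeval f p - monomialMap K e p ∈ weightGE ω (c + 1) := by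
  rw [p.as_sum, map_sum, map_sum, ← Finset.sum_sub_distrib]
  refine Submodule.sum_mem _ fun d hd => ?_
  have h1 := mem_weightGE.1 hp d hd
  have h2 : monomial d (coeff d p) = coeff d p • monomial d (1 : K) := by
    rw [smul_monomial, smul_eq_mul, mul_one]
  rw [h2, map_smul, map_smul, ← smul_sub, monomialMap_monomial]
  refine Submodule.smul_mem _ _ (weightGE_anti ω ?_ (aeval_monomial_sub_mem hf d))
  rw [weight_linearCombination]
  omega

theorem monomialMap_mem_weightGE {p : MvPolynomial τ K} {c : ℕ}
    (hp : p ∈ weightGE (fun J => Finsupp.weight ω (e J)) c) :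
    monomialMap K e p ∈ weightGE ω c := by
  rw [p.as_sum, map_sum]
  refine Submodule.sum_mem _ fun d hd => ?_
  rw [monomialMap_monomial]
  refine monomial_mem_weightGE ?_ _
  rw [weight_linearCombination]
  exact mem_weightGE.1 hp d hd

theorem isWeightedHomogeneous_monomialMap {p : MvPolynomial τ K} {c : ℕ}
    (hp : IsWeightedHomogeneous (fun J => Finsupp.weight ω (e J)) p c) :
    IsWeightedHomogeneous ω (monomialMap K e p) c := by
  rw [p.as_sum, map_sum]
  refine IsWeightedHomogeneous.sum _ _ _ fun d hd => ?_
  rw [monomialMap_monomial]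
  refine isWeightedHomogeneous_monomial _ _ _ ?_
  rw [weight_linearCombination]
  exact hp (mem_support_iff.1 hd)

/-- If the image of `p` under the substitution by `f` has no terms of the lowest weight of `p`, the
initial form of `p` is in the kernel of the monomial map. -/
theorem monomialMap_initialForm_eq_zero
    (hf : ∀ J, f J - monomial (e J) 1 ∈ weightGE ω (Finsupp.weight ω (e J) + 1))
    {p : MvPolynomial τ K}
    (hp : aeval f p ∈ weightGE ω (lowestWeight (fun J => Finsupp.weight ω (e J)) p + 1)) :
    monomialMap K e (initialForm (fun J => Finsupp.weight ω (e J)) p) = 0 := by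
  set w := fun J => Finsupp.weight ω (e J) with hw
  refine eq_zero_of_mem_weightGE
    (isWeightedHomogeneous_monomialMap (isWeightedHomogeneous_initialForm w p)) ?_
  have h1 : p ∈ weightGE w (lowestWeight w p) :=
    mem_weightGE.2 fun d hd => lowestWeight_le hd
  have h2 := aeval_sub_monomialMap_mem hf h1
  have h3 := monomialMap_mem_weightGE (sub_initialForm_mem w p)
  have h4 : monomialMap K e (initialForm w p) =
      aeval f p - (aeval f p - monomialMap K e p) - monomialMap K e (p - initialForm w p) := by
    rw [map_sub]
    ring
  rw [h4]
  exact Submodule.sub_mem _ (Submodule.sub_mem _ hp h2) h3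

theorem initialIdeal_ker_le
    (hf : ∀ J, f J - monomial (e J) 1 ∈ weightGE ω (Finsupp.weight ω (e J) + 1)) :
    initialIdeal (fun J => Finsupp.weight ω (e J)) (RingHom.ker (aeval (R := K) f)) ≤
      RingHom.ker (monomialMap K e) := by
  rw [initialIdeal, Ideal.span_le]
  rintro _ ⟨p, hp, rfl⟩
  rw [SetLike.mem_coe, RingHom.mem_ker]
  refine monomialMap_initialForm_eq_zero hf ?_
  rw [SetLike.mem_coe, RingHom.mem_ker] at hp
  rw [hp]
  exact Submodule.zero_mem _

/-- Let `S` be a set of monomials that the monomial map separates. A binomial in the kernel of the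
monomial map whose image under the substitution by `f` is a combination of the images of `S` lies in
the initial ideal: by comparison of lowest terms, the combination only uses monomials of higher
weight, so that the binomial is the initial form of a relation. -/
theorem binomial_mem_initialIdeal
    (hf : ∀ J, f J - monomial (e J) 1 ∈ weightGE ω (Finsupp.weight ω (e J) + 1))
    {S : Set (τ →₀ ℕ)} (hS : Set.InjOn (Finsupp.linearCombination ℕ e) S) {M N : τ →₀ ℕ}
    (hMN : Finsupp.linearCombination ℕ e M = Finsupp.linearCombination ℕ e N)
    (h : aeval f (monomial M (1 : K) - monomial N 1) ∈
      Submodule.span K ((fun s => aeval f (monomial s (1 : K))) '' S)) :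
    monomial M (1 : K) - monomial N 1 ∈
      initialIdeal (fun J => Finsupp.weight ω (e J)) (RingHom.ker (aeval (R := K) f)) := by
  classical
  set w := fun J => Finsupp.weight ω (e J) with hw
  set p := monomial M (1 : K) - monomial N 1 with hp
  rcases eq_or_ne p 0 with hp0 | hp0
  · rw [hp0]
    exact Ideal.zero_mem _
  set c := Finsupp.weight w M with hc
  have hN : Finsupp.weight w N = c := by
    rw [hc, ← weight_linearCombination, ← weight_linearCombination, hMN]
  have hph : IsWeightedHomogeneous w p c :=
    (isWeightedHomogeneous_monomial _ _ _ rfl).sub (isWeightedHomogeneous_monomial _ _ _ hN)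
  have hpc : aeval f p ∈ weightGE ω (c + 1) := by
    have h1 := aeval_sub_monomialMap_mem hf
      (p := p) (c := c) (mem_weightGE.2 fun d hd => (hph (mem_support_iff.1 hd)).ge)
    have h2 : monomialMap K e p = 0 := by
      rw [hp, map_sub, monomialMap_monomial, monomialMap_monomial, hMN, sub_self]
    rwa [h2, sub_zero] at h1
  obtain ⟨q, hq, hqp⟩ : ∃ q ∈ restrictSupport K S, aeval f q = aeval f p := by
    rw [restrictSupport_eq_span]
    have h1 : (fun s => aeval f (monomial s (1 : K))) '' S =
        (aeval (R := K) f).toLinearMap '' ((monomial · (1 : K)) '' S) := by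
      rw [Set.image_image]
      rfl
    rw [h1, ← Submodule.map_span] at h
    exact h
  rw [mem_restrictSupport_iff] at hq
  have hqc : q ∈ weightGE w (c + 1) := by
    rcases eq_or_ne q 0 with rfl | hq0
    · exact Submodule.zero_mem _
    rw [mem_weightGE]
    intro d hd
    refine le_trans ?_ (lowestWeight_le hd)
    by_contra hlt
    have h1 := monomialMap_initialForm_eq_zero hf (p := q)
      (by rw [hqp]; exact weightGE_anti ω (by rw [← hw]; omega) hpc)
    obtain ⟨s, hs⟩ := ne_zero_iff.1 (initialForm_ne_zero w hq0)
    have hsub : ∀ t ∈ (initialForm w q).support, t ∈ S := by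
      intro t ht
      rw [mem_support_iff, coeff_initialForm] at ht
      refine hq (mem_support_iff.2 fun h0 => ht ?_)
      rw [h0, ite_self]
    have h2 := congrArg (coeff (Finsupp.linearCombination ℕ e s)) h1
    rw [(initialForm w q).as_sum, map_sum, coeff_sum, coeff_zero,
      Finset.sum_eq_single s] at h2
    · rw [monomialMap_monomial, coeff_monomial, if_pos rfl] at h2
      exact hs h2
    · intro t ht hne
      rw [monomialMap_monomial, coeff_monomial, if_neg]
      exact fun he => hne (hS (hsub t ht) (hsub s (mem_support_iff.2 hs)) he)
    · intro hs'
      exact absurd (mem_support_iff.2 hs) hs'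
  refine Ideal.subset_span ⟨p - q, ?_, initialForm_eq hp0 hph ?_⟩
  · rw [SetLike.mem_coe, RingHom.mem_ker, map_sub, hqp, sub_self]
  · rw [sub_sub_cancel_left]
    exact Submodule.neg_mem _ hqc

end leading

end weights

/-! ### An exchange relation for alternating maps -/

section exchange

variable {R : Type*} [CommRing R]

/-- The alternating map obtained from `F` by fixing the arguments outside `p` to be those
of `u`. -/
def restrictAlternating {M ι : Type*} [AddCommGroup M] [Module R M]
    (F : M [⋀^ι]→ₗ[R] R) (p : ι → Prop) [DecidablePred p] (u : ι → M) :
    M [⋀^{i // p i}]→ₗ[R] R where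
  __ := F.toMultilinearMap.domDomRestrict p fun i => u i
  map_eq_zero_of_eq' := by
    intro y i j hij hne
    refine F.map_eq_zero_of_eq _ (i := i) (j := j) ?_ fun h => hne (Subtype.ext h)
    simp [i.2, j.2, hij]

/-- More than `card κ` vectors in `κ → R` are distributed over two alternating maps. The
alternating sum over all ways to do so vanishes, so that one product is controlled by the products
in which a vector of the second map has moved to the first. -/
theorem mul_mem_of_exchange [IsDomain R] {κ ιa ιb : Type*} [Fintype κ] [Fintype ιa] [Fintype ιb]
    (hcard : Fintype.card κ < Fintype.card ιa + Fintype.card ιb)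
    (f : (κ → R) [⋀^ιa]→ₗ[R] R) (g : (κ → R) [⋀^ιb]→ₗ[R] R) (v : ιa ⊕ ιb → κ → R)
    (W : AddSubgroup R)
    (h : ∀ σ : Equiv.Perm (ιa ⊕ ιb), (∃ a b, σ (Sum.inl a) = Sum.inr b) →
      f (fun a => v (σ (Sum.inl a))) * g (fun b => v (σ (Sum.inr b))) ∈ W) :
    f (fun a => v (Sum.inl a)) * g (fun b => v (Sum.inr b)) ∈ W := by
  classical
  have h0 : (LinearMap.mul' R R).compAlternatingMap (f.domCoprod g) v = 0 := by
    refine AlternatingMap.map_linearDependent _ _ fun hli => ?_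
    have := hli.fintype_card_le_finrank
    rw [Module.finrank_fintype_fun_eq_card, Fintype.card_sum] at this
    omega
  have hterm : ∀ σ : Equiv.Perm (ιa ⊕ ιb),
      LinearMap.mul' R R (AlternatingMap.domCoprod.summand f g (Quotient.mk'' σ) v) =
        Equiv.Perm.sign σ •
          (f (fun a => v (σ (Sum.inl a))) * g (fun b => v (σ (Sum.inr b)))) := by
    intro σ
    rw [AlternatingMap.domCoprod.summand_mk'', _root_.smul_apply]
    rcases Int.units_eq_one_or (Equiv.Perm.sign σ) with hs | hs <;> simp [hs]
  let q₀ : Equiv.Perm.ModSumCongr ιa ιb := Quotient.mk'' 1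
  rw [LinearMap.compAlternatingMap_apply, AlternatingMap.domCoprod_apply, _root_.sum_apply,
    map_sum, ← Finset.add_sum_erase _ _ (Finset.mem_univ q₀), hterm] at h0
  simp only [Equiv.Perm.sign_one, one_smul, Equiv.Perm.one_apply] at h0
  rw [eq_neg_of_add_eq_zero_left h0]
  refine W.neg_mem (AddSubgroup.sum_mem _ fun q hq => ?_)
  induction q using Quotient.inductionOn' with
  | h σ =>
    rw [hterm]
    have hσ : ∃ a b, σ (Sum.inl a) = Sum.inr b := by
      by_contra hcon
      push Not at hcon
      refine (Finset.mem_erase.1 hq).1 ?_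
      have hmaps : Set.MapsTo σ (Set.range Sum.inl) (Set.range Sum.inl) := by
        rintro _ ⟨a, rfl⟩
        rcases hx : σ (Sum.inl a) with x | x
        · exact ⟨x, rfl⟩
        · exact absurd hx (hcon a x)
      refine (QuotientGroup.eq.2 ?_ : (QuotientGroup.mk σ : _ ⧸ _) = QuotientGroup.mk 1)
      rw [mul_one]
      exact Subgroup.inv_mem _ (Equiv.Perm.mem_sumCongrHom_range_of_perm_mapsTo_inl hmaps)
    have h1 := h σ hσ
    rcases Int.units_eq_one_or (Equiv.Perm.sign σ) with hs | hs <;> rw [hs]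
    · rwa [one_smul]
    · rw [Units.neg_smul, one_smul]
      exact W.neg_mem h1

end exchange

/-- If `σ` moves an element of the upper part to the lower part, the sum over the upper part
decreases. -/
theorem sum_comp_perm_lt {ιa ιb : Type*} [Fintype ιa] [Fintype ιb] (v : ιa ⊕ ιb → ℕ) (θ : ℕ)
    (ha : ∀ a, θ ≤ v (Sum.inl a)) (hb : ∀ b, v (Sum.inr b) < θ) (σ : Equiv.Perm (ιa ⊕ ιb))
    (hσ : ∃ a b, σ (Sum.inl a) = Sum.inr b) :
    ∑ a, v (σ (Sum.inl a)) < ∑ a, v (Sum.inl a) := by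
  have h1 : ∑ a, v (σ (Sum.inl a)) < ∑ a, (θ + (v (σ (Sum.inl a)) - θ)) := by
    obtain ⟨a, b, hab⟩ := hσ
    refine Finset.sum_lt_sum (fun _ _ => by omega) ⟨a, Finset.mem_univ _, ?_⟩
    have := hb b
    rw [hab]
    omega
  have h2 : ∑ a, (v (σ (Sum.inl a)) - θ) ≤ ∑ a, (v (Sum.inl a) - θ) := by
    have h3 := Equiv.sum_comp σ fun x => v x - θ
    rw [Fintype.sum_sum_type, Fintype.sum_sum_type] at h3
    have h4 : ∑ b, (v (Sum.inr b) - θ) = 0 :=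
      Finset.sum_eq_zero fun b _ => by
        have := hb b
        omega
    omega
  have h5 : ∑ a, v (Sum.inl a) = ∑ a : ιa, (θ + (v (Sum.inl a) - θ)) :=
    Finset.sum_congr rfl fun a _ => by
      have := ha a
      omega
  rw [Finset.sum_add_distrib] at h1 h5
  omega

/-! ### Straightening products of two Plücker forms -/

section straightening

variable (K : Type*) [Field K] {n : ℕ}

/-- The minor of the matrix of variables with the first `k` rows and the columns `c`, which need
not be sorted or distinct. -/
noncomputable def columnMinor {k : ℕ} (hk : k ≤ n - 1) (c : Fin k → Fin n) :
    MvPolynomial (Fin (n - 1) × Fin n) K :=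
  Matrix.det (Matrix.of fun a b : Fin k => X (Fin.castLE hk a, c b))

/-- The column `j` of the matrix of variables, cut off after `k` rows. -/
noncomputable def variableColumn {k : ℕ} (hk : k ≤ n - 1) (j : Fin n) :
    Fin k → MvPolynomial (Fin (n - 1) × Fin n) K :=
  fun a => X (Fin.castLE hk a, j)

theorem columnMinor_eq {k : ℕ} (hk : k ≤ n - 1) (c : Fin k → Fin n) :
    columnMinor K hk c = Matrix.detRowAlternating fun b => variableColumn K hk (c b) := by
  rw [columnMinor, ← Matrix.det_transpose]
  rfl

theorem columnMinor_comp_perm {k : ℕ} (hk : k ≤ n - 1) (c : Fin k → Fin n)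
    (π : Equiv.Perm (Fin k)) :
    columnMinor K hk (c ∘ π) = Equiv.Perm.sign π • columnMinor K hk c := by
  rw [columnMinor_eq, columnMinor_eq, ← AlternatingMap.map_perm]
  rfl

theorem columnMinor_eq_zero {k : ℕ} (hk : k ≤ n - 1) {c : Fin k → Fin n}
    (hc : ¬Function.Injective c) : columnMinor K hk c = 0 := by
  rw [columnMinor_eq]
  exact AlternatingMap.map_eq_zero_of_not_injective _ _ fun h => hc
    (Function.Injective.of_comp (f := variableColumn K hk) h)

theorem columnMinor_orderEmbOfFin (J : PluckerIndex n) {k : ℕ} (hk : k ≤ n - 1)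
    (h : J.1.card = k) : columnMinor K hk (J.1.orderEmbOfFin h) = pluckerForm K J := by
  subst h
  rfl

/-- The span of the products of two Plücker forms with comparable indices. -/
noncomputable def standardSpan (n : ℕ) : Submodule K (MvPolynomial (Fin (n - 1) × Fin n) K) :=
  Submodule.span K {p | ∃ C D : PluckerIndex n, SubsetLE C.1 D.1 ∧
    pluckerForm K C * pluckerForm K D = p}

theorem exists_pluckerIndex_of_strictMono {k : ℕ} (hk0 : 0 < k) (hk : k ≤ n - 1)
    {c : Fin k → Fin n} (hc : StrictMono c) :
    ∃ (J : PluckerIndex n) (h : J.1.card = k), c = J.1.orderEmbOfFin h := by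
  have hcard : (Finset.univ.image c).card = k := by
    rw [Finset.card_image_of_injective _ hc.injective, Finset.card_univ, Fintype.card_fin]
  refine ⟨⟨Finset.univ.image c, ?_, ?_⟩, hcard,
    Finset.orderEmbOfFin_unique hcard (fun x => Finset.mem_image_of_mem _ (Finset.mem_univ _)) hc⟩
  · rw [← Finset.card_pos, hcard]
    exact hk0
  · rw [← Finset.card_lt_iff_ne_univ, hcard, Fintype.card_fin]
    omega

theorem subsetLE_of_orderEmbOfFin {C D : Finset (Fin n)} {k l : ℕ} (hC : C.card = k)
    (hD : D.card = l) (hlk : l ≤ k)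
    (h : ∀ r : Fin l, C.orderEmbOfFin hC (Fin.castLE hlk r) ≤ D.orderEmbOfFin hD r) :
    SubsetLE C D := by
  subst hC hD
  exact ⟨hlk, h⟩

/-- The induction step of the straightening law. If the columns violate the order at position `r`,
the exchange relation for the columns `c r, c (r + 1), …` and `d 0, …, d r`, which are one more than
there are rows, replaces the product by products in which the columns of the first minor are
smaller. -/
theorem columnMinor_mul_mem_of_lt {k l : ℕ} (hk : k ≤ n - 1) (hlk : l ≤ k) (W : AddSubgroup
    (MvPolynomial (Fin (n - 1) × Fin n) K)) {c : Fin k → Fin n} {d : Fin l → Fin n}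
    (hc : StrictMono c) (hd : StrictMono d) (r : Fin l) (hr : d r < c (Fin.castLE hlk r))
    (ih : ∀ (c' : Fin k → Fin n) (d' : Fin l → Fin n),
      ∑ i, (c' i : ℕ) < ∑ i, (c i : ℕ) →
        columnMinor K hk c' * columnMinor K (hlk.trans hk) d' ∈ W) :
    columnMinor K hk c * columnMinor K (hlk.trans hk) d ∈ W := by
  let P : Fin k → Prop := fun i => Fin.castLE hlk r ≤ i
  let Q : Fin l → Prop := fun j => j ≤ r
  let col := variableColumn K hk
  let f := restrictAlternating
    (Matrix.detRowAlternating (n := Fin k) (R := MvPolynomial (Fin (n - 1) × Fin n) K)) P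
      fun i => col (c i)
  let g := restrictAlternating
    ((Matrix.detRowAlternating (n := Fin l)
      (R := MvPolynomial (Fin (n - 1) × Fin n) K)).compLinearMap (LinearMap.funLeft _ _
        (Fin.castLE hlk))) Q fun j => col (d j)
  let x : {i // P i} ⊕ {j // Q j} → Fin n := Sum.elim (fun i => c i) (fun j => d j)
  have hf : ∀ y : {i // P i} → Fin n, f (fun i => col (y i)) =
      columnMinor K hk fun i => if h : P i then y ⟨i, h⟩ else c i := by
    intro y
    rw [columnMinor_eq]
    change Matrix.detRowAlternating _ = _
    congr 1
    ext i
    by_cases h : P i <;> simp [h, col]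
  have hg : ∀ y : {j // Q j} → Fin n, g (fun j => col (y j)) =
      columnMinor K (hlk.trans hk) fun j => if h : Q j then y ⟨j, h⟩ else d j := by
    intro y
    rw [columnMinor_eq]
    change Matrix.detRowAlternating _ = _
    congr 1
    ext j
    by_cases h : Q j <;> simp [h, col, variableColumn, LinearMap.funLeft]
  have key := mul_mem_of_exchange (κ := Fin k) ?_ f g (fun i => col (x i)) W ?_
  · rw [hf (fun i => x (Sum.inl i)), hg (fun j => x (Sum.inr j))] at key
    simpa [x] using key
  · have h1 : Fintype.card {i // P i} = k - r := by
      rw [Fintype.card_subtype]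
      simp only [P]
      rw [Finset.filter_le_eq_Ici, Fin.card_Ici]
      rfl
    have h2 : Fintype.card {j // Q j} = r + 1 := by
      rw [Fintype.card_subtype]
      simp only [Q]
      rw [Finset.filter_ge_eq_Iic, Fin.card_Iic]
    have := r.2
    rw [h1, h2, Fintype.card_fin]
    omega
  · intro σ hσ
    rw [hf (fun i => x (σ (Sum.inl i))), hg (fun j => x (σ (Sum.inr j)))]
    apply ih
    have h1 := sum_comp_perm_lt (fun i => (x i : ℕ)) (c (Fin.castLE hlk r))
      (fun a => hc.monotone a.2) (fun b => (hd.monotone b.2).trans_lt hr) σ hσ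
    rw [← Fintype.sum_subtype_add_sum_subtype P,
      ← Fintype.sum_subtype_add_sum_subtype P fun i => (c i : ℕ)]
    refine add_lt_add_of_lt_of_le (lt_of_eq_of_lt ?_ h1) (le_of_eq ?_)
    · exact Finset.sum_congr rfl fun i _ => by rw [dif_pos i.2]
    · exact Finset.sum_congr rfl fun i _ => by rw [dif_neg i.2]

theorem columnMinor_mul_mem {k l : ℕ} (hk : k ≤ n - 1) (hlk : l ≤ k) (hl : 0 < l) (N : ℕ) :
    ∀ (c : Fin k → Fin n) (d : Fin l → Fin n), ∑ i, (c i : ℕ) = N →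
      columnMinor K hk c * columnMinor K (hlk.trans hk) d ∈ standardSpan K n := by
  induction N using Nat.strong_induction_on with
  | _ N ih =>
    intro c d hN
    by_cases hc : Function.Injective c
    swap
    · rw [columnMinor_eq_zero K hk hc, zero_mul]
      exact Submodule.zero_mem _
    by_cases hd : Function.Injective d
    swap
    · rw [columnMinor_eq_zero K (hlk.trans hk) hd, mul_zero]
      exact Submodule.zero_mem _
    -- sorting the columns only changes the sign
    suffices hs : columnMinor K hk (c ∘ Tuple.sort c) *
        columnMinor K (hlk.trans hk) (d ∘ Tuple.sort d) ∈ standardSpan K n by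
      rw [columnMinor_comp_perm, columnMinor_comp_perm] at hs
      rcases Int.units_eq_one_or (Equiv.Perm.sign (Tuple.sort c)) with h1 | h1 <;>
      rcases Int.units_eq_one_or (Equiv.Perm.sign (Tuple.sort d)) with h2 | h2 <;>
      simpa [h1, h2] using hs
    have hc' : StrictMono (c ∘ Tuple.sort c) :=
      (Tuple.monotone_sort c).strictMono_of_injective (hc.comp (Equiv.injective _))
    have hd' : StrictMono (d ∘ Tuple.sort d) :=
      (Tuple.monotone_sort d).strictMono_of_injective (hd.comp (Equiv.injective _))
    have hN' : ∑ i, ((c ∘ Tuple.sort c) i : ℕ) = N := by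
      rw [← hN]
      exact Equiv.sum_comp (Tuple.sort c) fun i => (c i : ℕ)
    by_cases hviol : ∃ r : Fin l, (d ∘ Tuple.sort d) r < (c ∘ Tuple.sort c) (Fin.castLE hlk r)
    · obtain ⟨r, hr⟩ := hviol
      exact columnMinor_mul_mem_of_lt K hk hlk (standardSpan K n).toAddSubgroup hc' hd' r hr
        fun c'' d'' hlt => ih _ (hN' ▸ hlt) c'' d'' rfl
    · push Not at hviol
      obtain ⟨C, hC, hcC⟩ := exists_pluckerIndex_of_strictMono (hl.trans_le hlk) hk hc'
      obtain ⟨D, hD, hdD⟩ := exists_pluckerIndex_of_strictMono hl (hlk.trans hk) hd'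
      rw [hcC, hdD] at hviol ⊢
      rw [columnMinor_orderEmbOfFin, columnMinor_orderEmbOfFin]
      exact Submodule.subset_span ⟨C, D, subsetLE_of_orderEmbOfFin hC hD hlk hviol, rfl⟩

/-- Straightening law for two factors: each product of two Plücker forms is a combination of such
products with comparable indices. -/
theorem pluckerForm_mul_mem_standardSpan (A B : PluckerIndex n) :
    pluckerForm K A * pluckerForm K B ∈ standardSpan K n := by
  wlog h : B.1.card ≤ A.1.card generalizing A B
  · rw [mul_comm]
    exact this B A (not_le.1 h).le
  · exact columnMinor_mul_mem K A.card_le h (Finset.card_pos.2 B.2.1) _ _ _ rfl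

end straightening

/-! ### Diagonal terms of Plücker forms -/

section diagonal

variable (K : Type*) [Field K] {n : ℕ}

theorem sum_single_orderEmbOfFin (J : PluckerIndex n) :
    ∑ r : Fin J.1.card, Finsupp.single (Fin.castLE J.card_le r, J.1.orderEmbOfFin rfl r) 1 =
      diagExponent J.1 := by
  ext ⟨i, j⟩
  rw [Finsupp.finsetSum_apply, diagExponent_apply]
  by_cases hj : j ∈ J.1
  · obtain ⟨s, rfl⟩ : j ∈ Set.range (J.1.orderEmbOfFin rfl) := by
      rw [Finset.range_orderEmbOfFin]
      exact hj
    rw [Finset.sum_eq_single s]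
    · simp [Finsupp.single_apply, height_orderEmbOfFin, Fin.ext_iff]
    · intro r _ hr
      simp [hr]
    · simp
  · rw [if_neg fun h => hj h.1]
    refine Finset.sum_eq_zero fun r _ => ?_
    rw [Finsupp.single_apply, if_neg]
    intro h
    have h2 : J.1.orderEmbOfFin rfl r = j := congrArg Prod.snd h
    exact hj (h2 ▸ Finset.orderEmbOfFin_mem _ _ _)

/-- By the rearrangement inequality, the diagonal term is the only term of lowest weight. -/
theorem pluckerForm_sub_mem (J : PluckerIndex n) :
    pluckerForm K J - monomial (diagExponent J.1) 1 ∈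
      weightGE (diagWeight n) (Finsupp.weight (diagWeight n) (diagExponent J.1) + 1) := by
  classical
  set e : Equiv.Perm (Fin J.1.card) → (Fin (n - 1) × Fin n →₀ ℕ) := fun σ =>
    ∑ r, Finsupp.single (Fin.castLE J.card_le (σ r), J.1.orderEmbOfFin rfl r) 1 with he
  have hprod : ∀ σ : Equiv.Perm (Fin J.1.card),
      ∏ r, (X (Fin.castLE J.card_le (σ r), J.1.orderEmbOfFin rfl r) :
        MvPolynomial (Fin (n - 1) × Fin n) K) = monomial (e σ) 1 := by
    intro σ
    rw [he, monomial_sum_one]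
    rfl
  have hweight : ∀ σ, Finsupp.weight (diagWeight n) (e σ) =
      ∑ r, (σ r : ℕ) * (n - (J.1.orderEmbOfFin rfl r : ℕ)) := by
    intro σ
    rw [he, map_sum]
    refine Finset.sum_congr rfl fun r _ => ?_
    rw [Finsupp.weight_single, one_smul]
    rfl
  have h1 : e 1 = diagExponent J.1 := sum_single_orderEmbOfFin J
  have hlt : ∀ σ, σ ≠ 1 →
      Finsupp.weight (diagWeight n) (e 1) < Finsupp.weight (diagWeight n) (e σ) := by
    intro σ hσ
    rw [hweight, hweight]
    have hanti : Antivary (fun r : Fin J.1.card => (r : ℕ))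
        (fun r => n - (J.1.orderEmbOfFin rfl r : ℕ)) := by
      intro r s hrs
      by_contra hcon
      have := (J.1.orderEmbOfFin rfl).strictMono (Fin.lt_def.2 (not_le.1 hcon))
      rw [Fin.lt_def] at this
      simp only at hrs
      omega
    refine hanti.sum_mul_lt_sum_comp_perm_mul_iff.2 fun hcon => hσ ?_
    have hmono : Monotone σ := by
      intro r s hrs
      rcases hrs.eq_or_lt with rfl | hrs
      · exact le_rfl
      have h2 := (J.1.orderEmbOfFin rfl).strictMono hrs
      have h3 := (J.1.orderEmbOfFin rfl s).2
      rw [Fin.lt_def] at h2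
      exact hcon (show n - (J.1.orderEmbOfFin rfl s : ℕ) < n - (J.1.orderEmbOfFin rfl r : ℕ) by
        omega)
    have h4 : ⇑σ = id := ((hmono.strictMono_of_injective σ.injective).range_inj
      strictMono_id).1 (by rw [σ.surjective.range_eq, Set.range_id])
    exact Equiv.ext fun r => congrFun h4 r
  have hdet : pluckerForm K J = ∑ σ : Equiv.Perm (Fin J.1.card),
      Equiv.Perm.sign σ • monomial (e σ) (1 : K) := by
    rw [pluckerForm, Matrix.det_apply]
    refine Finset.sum_congr rfl fun σ _ => ?_
    rw [← hprod]
    rfl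
  rw [hdet, ← Finset.add_sum_erase _ _ (Finset.mem_univ 1), Equiv.Perm.sign_one, one_smul, h1,
    add_sub_cancel_left]
  refine Submodule.sum_mem _ fun σ hσ => ?_
  have h5 : monomial (e σ) (1 : K) ∈
      weightGE (diagWeight n) (Finsupp.weight (diagWeight n) (diagExponent J.1) + 1) :=
    monomial_mem_weightGE (h1 ▸ hlt σ (Finset.ne_of_mem_erase hσ)) 1
  rcases Int.units_eq_one_or (Equiv.Perm.sign σ) with hs | hs <;> rw [hs]
  · rwa [one_smul]
  · rw [Units.neg_smul, one_smul]
    exact Submodule.neg_mem _ h5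

theorem pluckerWeight_eq : (pluckerWeight K : PluckerIndex n → ℕ) =
    fun J => Finsupp.weight (diagWeight n) (diagExponent J.1) := by
  ext J
  exact lowestWeight_eq (by simp) (isWeightedHomogeneous_monomial _ _ _ rfl)
    (pluckerForm_sub_mem K J)

theorem initialTerm_eq (J : PluckerIndex n) :
    initialTerm K J = monomial (diagExponent J.1) 1 :=
  initialForm_eq (by simp) (isWeightedHomogeneous_monomial _ _ _ rfl) (pluckerForm_sub_mem K J)

end diagonal

/-! ### The initial ideal of the flag Plücker ideal -/

section initialIdeal

variable (K : Type*) [Field K] {n : ℕ}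

/-- Two ordered pairs with the same multiset of entries are equal. -/
theorem eq_and_eq_of_count_eq {a b a' b' : ℕ} (hab : b ≤ a) (hab' : b' ≤ a')
    (h : ∀ i, (if a = i then 1 else 0) + (if b = i then 1 else 0) =
      (if a' = i then 1 else 0) + if b' = i then 1 else 0) : a = a' ∧ b = b' := by
  have h1 : a' = a ∨ b' = a := by
    by_contra hcon
    push Not at hcon
    have := h a
    rw [if_neg hcon.1, if_neg hcon.2, if_pos rfl] at this
    omega
  have h2 : a' = b ∨ b' = b := by
    by_contra hcon
    push Not at hcon
    have := h b
    rw [if_neg hcon.1, if_neg hcon.2, if_pos rfl] at this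
    omega
  have h3 : a = a' ∨ b = a' := by
    by_contra hcon
    push Not at hcon
    have := h a'
    rw [if_neg hcon.1, if_neg hcon.2, if_pos rfl] at this
    omega
  have h4 : a = b' ∨ b = b' := by
    by_contra hcon
    push Not at hcon
    have := h b'
    rw [if_neg hcon.1, if_neg hcon.2, if_pos rfl] at this
    omega
  omega

/-- A pair of comparable subsets can be recovered from the number of paths through each point. -/
theorem injOn_totalExponent : Set.InjOn (totalExponent n)
    {M | ∃ C D : PluckerIndex n, SubsetLE C.1 D.1 ∧
      Finsupp.single C 1 + Finsupp.single D 1 = M} := by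
  rintro _ ⟨C, D, hCD, rfl⟩ _ ⟨C', D', hCD', rfl⟩ h
  rw [subsetLE_iff_height] at hCD hCD'
  have hcount : ∀ (A B : PluckerIndex n) (m i : ℕ),
      pathCount (Finsupp.single A 1 + Finsupp.single B 1) m i =
        (if height A.1 m = i then 1 else 0) + if height B.1 m = i then 1 else 0 := by
    intro A B m i
    unfold pathCount
    simp only [Finsupp.add_apply, add_mul, Finset.sum_add_distrib]
    congr 1 <;>
    · rw [Finset.sum_eq_single_of_mem _ (Finset.mem_univ _)]
      · rw [Finsupp.single_eq_same, one_mul]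
      · intro J _ hJ
        rw [Finsupp.single_eq_of_ne hJ, zero_mul]
  have key : ∀ m ≤ n, height C.1 m = height C'.1 m ∧ height D.1 m = height D'.1 m := by
    intro m hm
    have h1 : ∀ i, (if height C.1 m = i then 1 else 0) + (if height D.1 m = i then 1 else 0) =
        (if height C'.1 m = i then 1 else 0) + if height D'.1 m = i then 1 else 0 := by
      intro i
      rw [← hcount, ← hcount]
      exact pathCount_congr h hm i
    exact eq_and_eq_of_count_eq (hCD m) (hCD' m) h1
  have hext : ∀ A B : Finset (Fin n), (∀ m ≤ n, height A m = height B m) → A = B := by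
    intro A B hAB
    refine height_injective (funext fun m => ?_)
    rcases le_total m n with hm | hm
    · exact hAB m hm
    · rw [height_of_le _ hm, height_of_le _ hm, ← height_of_le A le_rfl, hAB n le_rfl,
        height_of_le _ le_rfl]
  rw [Subtype.ext (hext C.1 C'.1 fun m hm => (key m hm).1),
    Subtype.ext (hext D.1 D'.1 fun m hm => (key m hm).2)]

theorem tailSwap_mem_initialPluckerIdeal (A B : PluckerIndex n) (m : ℕ)
    (h : height A.1 m = height B.1 m) :
    (X A * X B - X (A.tailSwap B m h) * X (B.tailSwap A m h.symm) :
      MvPolynomial (PluckerIndex n) K) ∈ initialPluckerIdeal K n := by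
  have hX : ∀ C D : PluckerIndex n, (X C * X D : MvPolynomial (PluckerIndex n) K) =
      monomial (Finsupp.single C 1 + Finsupp.single D 1) 1 := by
    intro C D
    rw [X, X, monomial_mul, one_mul]
  have hspan : ∀ C D : PluckerIndex n,
      aeval (pluckerForm K) (X C * X D : MvPolynomial (PluckerIndex n) K) ∈ standardSpan K n := by
    intro C D
    rw [map_mul, aeval_X, aeval_X]
    exact pluckerForm_mul_mem_standardSpan K C D
  rw [initialPluckerIdeal, pluckerWeight_eq, hX, hX]
  refine binomial_mem_initialIdeal (pluckerForm_sub_mem K) injOn_totalExponent ?_ ?_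
  · change totalExponent n _ = totalExponent n _
    rw [map_add, map_add]
    simp only [totalExponent_single]
    exact (diagExponent_tailSwap_add h).symm
  · rw [← hX, ← hX, map_sub]
    have hS : standardSpan K n = Submodule.span K
        ((fun s => aeval (pluckerForm K) (monomial s (1 : K))) ''
          {M | ∃ C D : PluckerIndex n, SubsetLE C.1 D.1 ∧
            Finsupp.single C 1 + Finsupp.single D 1 = M}) := by
      unfold standardSpan
      congr 1
      ext p
      constructor
      · rintro ⟨C, D, hCD, rfl⟩
        exact ⟨_, ⟨C, D, hCD, rfl⟩, by simp only [← hX, map_mul, aeval_X]⟩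
      · rintro ⟨_, ⟨C, D, hCD, rfl⟩, rfl⟩
        exact ⟨C, D, hCD, by simp only [← hX, map_mul, aeval_X]⟩
    rw [← hS]
    exact Submodule.sub_mem _ (hspan _ _) (hspan _ _)

theorem monomial_sub_mem_initialPluckerIdeal {M N : PluckerIndex n →₀ ℕ}
    (h : totalExponent n M = totalExponent n N) :
    monomial M (1 : K) - monomial N 1 ∈ initialPluckerIdeal K n :=
  monomial_sub_monomial_mem_of_tailSwap _ (tailSwap_mem_initialPluckerIdeal K) h

/-- The initial ideal of the flag Plücker ideal is the kernel of the monomial map given by the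
diagonal terms. -/
theorem initialPluckerIdeal_eq_ker :
    initialPluckerIdeal K n =
      RingHom.ker (monomialMap K fun J : PluckerIndex n => diagExponent J.1) := by
  apply le_antisymm
  · rw [initialPluckerIdeal, pluckerWeight_eq]
    exact initialIdeal_ker_le (pluckerForm_sub_mem K)
  · rw [ker_monomialMap, Ideal.span_le]
    rintro _ ⟨⟨M, N⟩, h, rfl⟩
    exact monomial_sub_mem_initialPluckerIdeal K h

end initialIdeal

/-! ### Restriction to a Richardson set -/

section restriction

variable (K : Type*) [Field K] {n : ℕ}

theorem linearCombination_mapDomain (T : Set (PluckerIndex n)) (M : T →₀ ℕ) :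
    totalExponent n (M.mapDomain (↑)) =
      Finsupp.linearCombination ℕ (fun J : T => diagExponent J.1.1) M :=
  Finsupp.linearCombination_mapDomain ℕ _ M

/-- For a swap-closed set of variables, the restriction of the initial ideal is the kernel of the
restricted monomial map. -/
theorem restrictIdeal_eq_ker {T : Set (PluckerIndex n)} (hT : SwapClosed T) :
    restrictIdeal T (initialPluckerIdeal K n) =
      RingHom.ker (monomialMap K fun J : T => diagExponent J.1.1) := by
  have hinj : Function.Injective ((↑) : T → PluckerIndex n) := Subtype.val_injective
  apply le_antisymm
  · rw [initialPluckerIdeal_eq_ker, ker_monomialMap, restrictIdeal, Ideal.map_span, Ideal.span_le]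
    rintro _ ⟨_, ⟨⟨M, N⟩, h, rfl⟩, rfl⟩
    change totalExponent n M = totalExponent n N at h
    change killCompl hinj (monomial M 1 - monomial N 1) ∈ RingHom.ker _
    rw [map_sub]
    -- either both monomials survive or both vanish
    by_cases hM : ∀ J ∈ M.support, J ∈ T
    · have hN : ∀ J ∈ N.support, J ∈ T := fun J hJ => hT.mem_of_totalExponent_eq h hM hJ
      have hM' : (M.support : Set (PluckerIndex n)) ⊆ Set.range ((↑) : T → PluckerIndex n) := by
        rw [Subtype.range_coe]
        exact hM
      have hN' : (N.support : Set (PluckerIndex n)) ⊆ Set.range ((↑) : T → PluckerIndex n) := by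
        rw [Subtype.range_coe]
        exact hN
      rw [killCompl_monomial_eq_monomial_comapDomain_of_subset hinj _ hM',
        killCompl_monomial_eq_monomial_comapDomain_of_subset hinj _ hN', RingHom.mem_ker, map_sub,
        monomialMap_monomial, monomialMap_monomial, ← linearCombination_mapDomain,
        ← linearCombination_mapDomain, Finsupp.mapDomain_comapDomain _ hinj _ hM',
        Finsupp.mapDomain_comapDomain _ hinj _ hN', h, sub_self]
    · have hN : ¬∀ J ∈ N.support, J ∈ T := fun hN =>
        hM fun J hJ => hT.mem_of_totalExponent_eq h.symm hN hJ
      rw [killCompl_monomial_eq_zero_of_not_subset hinj, killCompl_monomial_eq_zero_of_not_subset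
        hinj, sub_self]
      · exact Ideal.zero_mem _
      · rw [Subtype.range_coe]
        exact hN
      · rw [Subtype.range_coe]
        exact hM
  · rw [ker_monomialMap, Ideal.span_le]
    rintro _ ⟨⟨M, N⟩, h, rfl⟩
    have h1 := Ideal.mem_map_of_mem (killCompl hinj)
      (monomial_sub_mem_initialPluckerIdeal K (M := M.mapDomain (↑)) (N := N.mapDomain (↑)) (by
        rw [linearCombination_mapDomain, linearCombination_mapDomain]
        exact h))
    rwa [map_sub, killCompl_monomial_mapDomain, killCompl_monomial_mapDomain] at h1

theorem isToric_ker_monomialMap {σ τ : Type*} (e : τ → σ →₀ ℕ) :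
    IsToric (RingHom.ker (monomialMap K e)) :=
  ⟨RingHom.ker_isPrime _, _, ker_monomialMap e⟩

theorem isMonomialFree_ker_monomialMap {σ τ : Type*} (e : τ → σ →₀ ℕ) :
    IsMonomialFree (RingHom.ker (monomialMap K e)) := by
  intro d hd
  rw [RingHom.mem_ker, monomialMap_monomial, monomial_eq_zero] at hd
  exact one_ne_zero hd

/-- If two paths in `T` have a tail swap outside `T`, the corresponding binomial restricts to a
monomial. -/
theorem swapClosed_of_isMonomialFree {T : Set (PluckerIndex n)}
    (h : IsMonomialFree (restrictIdeal T (initialPluckerIdeal K n))) : SwapClosed T := by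
  intro A hA B hB m hm
  by_contra hcon
  have hinj : Function.Injective ((↑) : T → PluckerIndex n) := Subtype.val_injective
  have h1 := Ideal.mem_map_of_mem (killCompl hinj) (tailSwap_mem_initialPluckerIdeal K A B m hm)
  have h2 : ∀ C : T, killCompl (R := K) hinj (X C.1) = X C := fun C => by
    rw [← rename_X, killCompl_rename_app]
  have h3 : killCompl (R := K) hinj (X (A.tailSwap B m hm)) = 0 := by
    rw [X, killCompl_monomial_eq_zero_of_not_subset]
    rw [Finsupp.support_single _ one_ne_zero, Subtype.range_coe]
    simpa using hcon
  rw [map_sub, map_mul, map_mul, h3, zero_mul, sub_zero, h2 ⟨A, hA⟩, h2 ⟨B, hB⟩, X, X,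
    monomial_mul, one_mul] at h1
  exact h _ h1

theorem restrictedMonomialMap_eq (v w : Equiv.Perm (Fin n)) :
    restrictedMonomialMap K v w =
      monomialMap K fun J : richardsonSet v w => diagExponent J.1.1 := by
  unfold restrictedMonomialMap monomialMap
  simp only [initialTerm_eq]

end restriction

end FlagRichardson

theorem theorem4p1 {K : Type*} [Field K] [IsAlgClosed K] (n : ℕ) (hn : 1 ≤ n)
    (v w : Equiv.Perm (Fin n)) (hvw : FlagRichardson.BruhatLE v w) :
    (FlagRichardson.IsMonomialFree
        (FlagRichardson.restrictIdeal (FlagRichardson.richardsonSet v w)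
          (FlagRichardson.initialPluckerIdeal K n)) ↔
      FlagRichardson.InT v w) ∧
    (FlagRichardson.InT v w →
      FlagRichardson.IsToric
        (FlagRichardson.restrictIdeal (FlagRichardson.richardsonSet v w)
          (FlagRichardson.initialPluckerIdeal K n)) ∧
      FlagRichardson.restrictIdeal (FlagRichardson.richardsonSet v w)
          (FlagRichardson.initialPluckerIdeal K n) =
        RingHom.ker (FlagRichardson.restrictedMonomialMap K v w)) := by
  rw [FlagRichardson.inT_iff_swapClosed hn hvw, FlagRichardson.restrictedMonomialMap_eq]
  refine ⟨⟨FlagRichardson.swapClosed_of_isMonomialFree K, fun h => ?_⟩, fun h => ?_⟩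
  · rw [FlagRichardson.restrictIdeal_eq_ker K h]
    exact FlagRichardson.isMonomialFree_ker_monomialMap K _
  · rw [FlagRichardson.restrictIdeal_eq_ker K h]
    exact ⟨FlagRichardson.isToric_ker_monomialMap K _, rfl⟩
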